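/- \textbf{Corollary (quantization).} Let $\omega=-\tfrac12+\tfrac{\sqrt3}{2}\sqrt{-1}$ and let $\mathbb{Z}[\omega]=\{a+b\omega:a,b\in\mathbb{Z}\}\subset\mathbb{C}$ be the ring of Eisenstein integers. For each $n$ let $q=q_n$ be a natural prime with $q\equiv 1 \pmod 3$, let $\varrho=\varrho_n$ be an Eisenstein prime with $|\varrho|^2=q$, let $\sigma=\sigma_n:\mathbb{Z}[\omega]/\varrho\mathbb{Z}[\omega]\to\mathbb{F}_q$ be a ring isomorphism, and let $\tilde\sigma:\mathbb{Z}[\omega]\to\mathbb{F}_q$ be reduction modulo $\varrho$ followed by $\sigma$, applied componentwise to vectors. For $k=k_n\ge 0$ and a matrix $\mathbf{G}\in\mathbb{F}_q^{n\times k}$, Construction A yields the lattice $$\Lambda=\varrho^{-1}\{\lambda\in\mathbb{Z}[\omega]^n:\tilde\sigma(\lambda)\in\mathcal{C}\}\subset\mathbb{C}^n,\qquad \mathcal{C}=\{\mathbf{G}y:y\in\mathbb{F}_q^k\}.$$ Let $\Lambda=\Lambda_n$ be the random lattice obtained when the entries of $\mathbf{G}=\mathbf{G}_n$ are i.i.d.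 uniform over $\mathbb{F}_q$. Suppose that there are constants $\beta<1$ and $0<r_{\min}<\tfrac14$ such that, for all sufficiently large $n$, $$k\le\beta n,\qquad q^k=\frac{(\sqrt3/2)^n\,\Gamma(n+1)}{\pi^n\, r_n^{2n}}\quad\text{with}\quad r_{\min}<r_n<2r_{\min}$$ (so $r_n$ is the effective radius of $\Lambda$ whenever $\mathbf{G}$ has full column rank), and that $k$ grows faster than $\log^2 n$, i.e. $\log^2 n/k\to0$. Then $\Lambda$ is good for quantization in probability: $$G(\Lambda)\longrightarrow\frac{1}{2\pi e}\quad\text{in probability as } n\to\infty.$$ Here $\mathbb{C}^n$ is identified with $\mathbb{R}^{2n}$, $\mathcal{V}_\Lambda=\{x\in\mathbb{C}^n:\|x\|\le\|x-v\|\ \text{for all } v\in\Lambda\}$ is the fundamental Voronoi region, and $G(\Lambda)$ is the normalized second moment $$G(\Lambda)=\frac{\sigma_\Lambda^2}{\mathrm{Vol}(\mathcal{V}_\Lambda)^{1/n}},\qquad \sigma_\Lambda^2=\frac{1}{2n}\cdot\frac{1}{\mathrm{Vol}(\mathcal{V}_\Lambda)}\int_{\mathcal{V}_\Lambda}\|x\|^2\,dx.$$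 -/

import Mathlib

open MeasureTheory ProbabilityTheory Filter Asymptotics

noncomputable section

namespace EisensteinLattice

/-- The primitive cube root of unity `ω = -1/2 + j √3/2`. -/
def omega : ℂ := ⟨-1 / 2, Real.sqrt 3 / 2⟩

theorem omega_sq : omega * omega = -1 - omega := by
  have h : Real.sqrt 3 * Real.sqrt 3 = 3 := Real.mul_self_sqrt (by norm_num)
  apply Complex.ext
  · simp only [omega, Complex.mul_re, Complex.sub_re, Complex.neg_re, Complex.one_re]
    nlinarith
  · simp only [omega, Complex.mul_im, Complex.sub_im, Complex.neg_im, Complex.one_im]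
    ring

/-- The ring `ℤ[ω]` of Eisenstein integers `a + b ω`, as a subring of `ℂ`. -/
def eisensteinIntegers : Subring ℂ where
  carrier := {z | ∃ a b : ℤ, z = a + b * omega}
  zero_mem' := ⟨0, 0, by simp⟩
  one_mem' := ⟨1, 0, by simp⟩
  add_mem' := by
    rintro _ _ ⟨a, b, rfl⟩ ⟨c, d, rfl⟩
    exact ⟨a + c, b + d, by push_cast; ring⟩
  neg_mem' := by
    rintro _ ⟨a, b, rfl⟩
    exact ⟨-a, -b, by push_cast; ring⟩
  mul_mem' := by
    rintro _ _ ⟨a, b, rfl⟩ ⟨c, d, rfl⟩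
    refine ⟨a * c - b * d, a * d + b * c - b * d, ?_⟩
    push_cast
    linear_combination (b * d : ℂ) * omega_sq

/-- The ring homomorphism `ℤ[ω] → ℤ[ω]/ϱℤ[ω] ≅ 𝔽_q` given by reduction modulo `ϱ` followed by the
isomorphism `σ`. -/
def labeling {q : ℕ} {ϱ : eisensteinIntegers}
    (σ : (eisensteinIntegers ⧸ Ideal.span {ϱ}) ≃+* ZMod q) : eisensteinIntegers →+* ZMod q :=
  σ.toRingHom.comp (Ideal.Quotient.mk (Ideal.span {ϱ}))

/-- The linear code `{G y : y ∈ 𝔽_q^k}` generated by the columns of the `n × k` matrix `G`. -/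
def codebook {n k q : ℕ} (G : Matrix (Fin n) (Fin k) (ZMod q)) :
    Submodule (ZMod q) (Fin n → ZMod q) :=
  LinearMap.range G.mulVecLin

/-- Construction A: the lattice `ϱ⁻¹ {ℓ ∈ ℤ[ω]ⁿ : ℓ reduces componentwise to a codeword}` in `ℂⁿ`. -/
def constructionA {n k q : ℕ} (ϱ : eisensteinIntegers)
    (σ : (eisensteinIntegers ⧸ Ideal.span {ϱ}) ≃+* ZMod q)
    (G : Matrix (Fin n) (Fin k) (ZMod q)) : AddSubgroup (EuclideanSpace ℂ (Fin n)) where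
  carrier := {x | ∃ ℓ : Fin n → eisensteinIntegers,
    (fun i => labeling σ (ℓ i)) ∈ codebook G ∧ ∀ i, x i = (ϱ : ℂ)⁻¹ * (ℓ i : ℂ)}
  zero_mem' := by
    refine ⟨0, ?_, fun i => by simp⟩
    have h : (fun i : Fin n => labeling σ ((0 : Fin n → eisensteinIntegers) i)) = 0 := by
      ext i; simp
    rw [h]; exact zero_mem _
  add_mem' := by
    rintro x y ⟨ℓ, hℓ, hx⟩ ⟨m, hm, hy⟩
    refine ⟨ℓ + m, ?_, fun i => by simp [hx, hy, mul_add]⟩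
    have h : (fun i : Fin n => labeling σ ((ℓ + m) i)) =
        (fun i => labeling σ (ℓ i)) + (fun i => labeling σ (m i)) := by
      ext i; simp
    rw [h]; exact add_mem hℓ hm
  neg_mem' := by
    rintro x ⟨ℓ, hℓ, hx⟩
    refine ⟨-ℓ, ?_, fun i => by simp [hx]⟩
    have h : (fun i : Fin n => labeling σ ((-ℓ) i)) = -(fun i => labeling σ (ℓ i)) := by
      ext i; simp
    rw [h]; exact neg_mem hℓ

section SecondMoment

variable {E : Type*} [NormedAddCommGroup E] [InnerProductSpace ℝ E] [FiniteDimensional ℝ E]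
  [MeasurableSpace E] [BorelSpace E]

/-- The (closed) fundamental Voronoi region: the points at least as close to `0` as to any other
lattice point. -/
def voronoiRegion (Λ : AddSubgroup E) : Set E :=
  {x | ∀ v ∈ Λ, ‖x‖ ≤ ‖x - v‖}

/-- The second moment per real dimension of a uniform point of the Voronoi region,
`σ²(Λ) = (1/N) Vol(𝒱)⁻¹ ∫_𝒱 ‖x‖² dx`, where `N` is the real dimension. -/
def secondMoment (Λ : AddSubgroup E) : ℝ :=
  (1 / (Module.finrank ℝ E : ℝ)) *
    ((∫ x in voronoiRegion Λ, ‖x‖ ^ 2) / volume.real (voronoiRegion Λ))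

/-- The normalized second moment `G(Λ) = σ²(Λ) / Vol(𝒱)^(2/N)`. -/
def normalizedSecondMoment (Λ : AddSubgroup E) : ℝ :=
  secondMoment Λ / volume.real (voronoiRegion Λ) ^ (2 / (Module.finrank ℝ E : ℝ))

end SecondMoment

/-- The entries of the random matrix `G` are i.i.d. and uniformly distributed over `𝔽_q`. -/
def IsIIDUniform {Ω : Type*} [MeasurableSpace Ω] (P : Measure Ω) {n k q : ℕ} [NeZero q]
    (G : Ω → Matrix (Fin n) (Fin k) (ZMod q)) : Prop :=
  (∀ i j, Measurable fun ω => G ω i j) ∧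
  iIndepFun (fun (p : Fin n × Fin k) ω => G ω p.1 p.2) P ∧
  ∀ i j, P.map (fun ω => G ω i j) = (PMF.uniformOfFintype (ZMod q)).toMeasure

end EisensteinLattice

end

noncomputable section

namespace EisensteinLattice

/-! ### The Eisenstein integers in the complex plane -/

/-! Write r for the effective radius. When G has full column rank, ℤ[ω]ⁿ has index q^k in Λ, so the
Voronoi region has the volume of a ball of radius r, and `normalizedSecondMoment_eq` reads G(Λ) =
((n!)^(1/n) / n) / (2π) · M / r², where M is the mean of ‖x‖² over the Voronoi region. Stirling
sends the first factor to 1/(2πe), so the claim becomes M / r² → 1 in probability.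

The lower bound is deterministic: a ball of radius (1 - δ)r fills only a fraction (1 - δ)^(2n) of
the Voronoi volume, so nearly all the mass has norm at least (1 - δ)r
(`le_integral_norm_sq_voronoiRegion`).

For the upper bound, ℤ[ω]ⁿ ⊆ Λ forces ‖x‖² ≤ n on the Voronoi region. It is therefore enough that
the part of space farther than (1 + δ)r from Λ has density at most δr²/n
(`integral_norm_sq_voronoiRegion_le`). Fix x. Codewords whose messages have first coordinate 1 are
uniform and pairwise independent, so Chebyshev's inequality bounds the probability that none of them
labels a point of ϱ⁻¹ℤ[ω]ⁿ near x (`card_code_misses_mul_le`, `card_lt_infDist_mul_le`). Integrating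
over x in one period and applying Markov's inequality bounds the number of bad matrices
(`card_volume_lt_infDist_mul_le`).

The failure probability is at most q^k / q^n for rank deficiency plus a constant times n q / (1 +
δ/2)^(2n) for bad covering. Since k log q = n log n + O(n), the growth of k makes q subexponential
in n, while β < 1 gives n / q → 0, so that the grid ϱ⁻¹ℤ[ω]ⁿ is fine enough for volume to count its
points. -/

theorem eq_coords (z : ℂ) :
    z = ((z.re + z.im / √3 : ℝ) : ℂ) + ((2 * z.im / √3 : ℝ) : ℂ) * omega := by
  have h : √3 ≠ 0 := by positivity
  apply Complex.ext
  · simp [omega]; field_simp; ring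
  · simp [omega]; field_simp

theorem normSq_coords (a b : ℝ) :
    ‖(a : ℂ) + (b : ℂ) * omega‖ ^ 2 = a ^ 2 - a * b + b ^ 2 := by
  have h : √3 * √3 = 3 := Real.mul_self_sqrt (by norm_num)
  rw [← Complex.normSq_eq_norm_sq, Complex.normSq_apply]
  simp only [omega, Complex.add_re, Complex.add_im, Complex.mul_re, Complex.mul_im,
    Complex.ofReal_re, Complex.ofReal_im]
  linear_combination (b ^ 2 / 4) * h

theorem coords_re (a b : ℝ) :
    ((a : ℂ) + (b : ℂ) * omega).re + ((a : ℂ) + (b : ℂ) * omega).im / √3 = a := by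
  have h : √3 ≠ 0 := by positivity
  simp [omega]; field_simp; ring

theorem coords_im (a b : ℝ) : 2 * ((a : ℂ) + (b : ℂ) * omega).im / √3 = b := by
  have h : √3 ≠ 0 := by positivity
  simp [omega]; field_simp

/-- The norm form a² - ab + b² is integer valued, so once positive it is at least 1. Discreteness of
the lattices and uniqueness of labels in small balls both rest on this gap. -/
theorem one_le_norm_of_ne_zero (u : eisensteinIntegers) (hu : u ≠ 0) : 1 ≤ ‖(u : ℂ)‖ := by
  obtain ⟨a, b, hab⟩ := u.2
  have h := normSq_coords a b
  have hu' : (u : ℂ) ≠ 0 := by simpa using hu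
  have hpos : 0 < ‖(u : ℂ)‖ ^ 2 := by positivity
  have he : ‖(u : ℂ)‖ ^ 2 = ((a ^ 2 - a * b + b ^ 2 : ℤ) : ℝ) := by
    rw [hab]; push_cast; exact_mod_cast h
  rw [he] at hpos
  have h1 : (1 : ℤ) ≤ a ^ 2 - a * b + b ^ 2 := by exact_mod_cast hpos
  have h2 : (1 : ℝ) ≤ ‖(u : ℂ)‖ ^ 2 := by rw [he]; exact_mod_cast h1
  nlinarith [norm_nonneg (u : ℂ)]

instance : Countable eisensteinIntegers := by
  have : Function.Surjective (fun p : ℤ × ℤ =>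
      (⟨p.1 + p.2 * omega, p.1, p.2, rfl⟩ : eisensteinIntegers)) := by
    rintro ⟨_, a, b, rfl⟩
    exact ⟨(a, b), rfl⟩
  exact this.countable

/-- The fundamental parallelogram `{a + b ω : a, b ∈ [-1/2, 1/2)}` of `ℤ[ω]`. -/
def parallelogram : Set ℂ :=
  {z | z.re + z.im / √3 ∈ Set.Ico (-1 / 2 : ℝ) (1 / 2) ∧ 2 * z.im / √3 ∈ Set.Ico (-1 / 2 : ℝ) (1 / 2)}

theorem measurableSet_parallelogram : MeasurableSet parallelogram := by
  have h1 : Measurable fun z : ℂ => z.re + z.im / √3 := by fun_prop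
  have h2 : Measurable fun z : ℂ => 2 * z.im / √3 := by fun_prop
  exact (h1 measurableSet_Ico).inter (h2 measurableSet_Ico)

theorem norm_sq_le_one_of_mem_parallelogram {z : ℂ} (hz : z ∈ parallelogram) : ‖z‖ ^ 2 ≤ 1 := by
  obtain ⟨⟨h1, h2⟩, h3, h4⟩ := hz
  rw [eq_coords z, normSq_coords]
  nlinarith

theorem exists_sub_mem_parallelogram (z : ℂ) :
    ∃ u : eisensteinIntegers, z - u ∈ parallelogram := by
  set a := z.re + z.im / √3 with ha
  set b := 2 * z.im / √3 with hb
  refine ⟨⟨(⌊a + 1 / 2⌋ : ℤ) + (⌊b + 1 / 2⌋ : ℤ) * omega, _, _, rfl⟩, ?_⟩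
  have hz : z - ((⌊a + 1 / 2⌋ : ℤ) + (⌊b + 1 / 2⌋ : ℤ) * omega) =
      ((a - ⌊a + 1 / 2⌋ : ℝ) : ℂ) + ((b - ⌊b + 1 / 2⌋ : ℝ) : ℂ) * omega := by
    conv_lhs => rw [eq_coords z]
    push_cast
    simp only [ha, hb]
    push_cast
    ring
  simp only [hz, parallelogram, Set.mem_ofPred_eq, coords_re, coords_im, Set.mem_Ico]
  have := Int.floor_le (a + 1 / 2)
  have := Int.lt_floor_add_one (a + 1 / 2)
  have := Int.floor_le (b + 1 / 2)
  have := Int.lt_floor_add_one (b + 1 / 2)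
  refine ⟨⟨?_, ?_⟩, ?_, ?_⟩ <;> linarith

theorem eq_of_sub_mem_parallelogram {z : ℂ} {u v : eisensteinIntegers}
    (hu : z - u ∈ parallelogram) (hv : z - v ∈ parallelogram) : u = v := by
  obtain ⟨_, a, b, rfl⟩ := u
  obtain ⟨_, c, d, rfl⟩ := v
  have key : ∀ s t : ℤ, z - (s + t * omega) =
      ((z.re + z.im / √3 - s : ℝ) : ℂ) + ((2 * z.im / √3 - t : ℝ) : ℂ) * omega := by
    intro s t
    conv_lhs => rw [eq_coords z]
    push_cast
    ring
  simp only [key, parallelogram, Set.mem_ofPred_eq, coords_re, coords_im, Set.mem_Ico] at hu hv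
  obtain ⟨⟨h1, h2⟩, h3, h4⟩ := hu
  obtain ⟨⟨h5, h6⟩, h7, h8⟩ := hv
  have e1 : a = c := by
    have l1 : (a : ℝ) < c + 1 := by linarith
    have l2 : (c : ℝ) < a + 1 := by linarith
    have l1' : a < c + 1 := by exact_mod_cast l1
    have l2' : c < a + 1 := by exact_mod_cast l2
    omega
  have e2 : b = d := by
    have l1 : (b : ℝ) < d + 1 := by linarith
    have l2 : (d : ℝ) < b + 1 := by linarith
    have l1' : b < d + 1 := by exact_mod_cast l1
    have l2' : d < b + 1 := by exact_mod_cast l2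
    omega
  subst e1 e2
  rfl

theorem volume_parallelogram : volume parallelogram = ENNReal.ofReal (√3 / 2) := by
  have h3 : √3 ≠ 0 := by positivity
  -- The rows express the coordinates in the basis 1, ω as functionals of (re z, im z).
  let M : Matrix (Fin 2) (Fin 2) ℝ := !![1, 1 / √3; 0, 2 / √3]
  have hdet : LinearMap.det (Matrix.toLin' M) = 2 / √3 := by
    rw [LinearMap.det_toLin', Matrix.det_fin_two_of]; ring
  have hset : parallelogram = Complex.measurableEquivPi ⁻¹'
      (Matrix.toLin' M ⁻¹' Set.univ.pi fun _ => Set.Ico (-1 / 2 : ℝ) (1 / 2)) := by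
    ext z
    simp only [parallelogram, Set.mem_preimage, Set.mem_pi, Set.mem_univ, true_imp_iff,
      Fin.forall_fin_two, Set.mem_ofPred_eq]
    have e : Complex.measurableEquivPi z = ![z.re, z.im] := rfl
    rw [e]
    simp [M, Matrix.toLin'_apply, Matrix.mulVec, dotProduct, Fin.sum_univ_two]
    ring_nf
  rw [hset, Complex.volume_preserving_equiv_pi.measure_preimage_equiv,
    Measure.addHaar_preimage_linearMap _ (by rw [hdet]; positivity), hdet, Real.volume_pi_Ico]
  have : |(2 / √3)⁻¹| = √3 / 2 := by rw [abs_of_pos (by positivity), inv_div]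
  rw [this]
  norm_num

/-! ### Volumes in `ℂⁿ` -/

theorem finrank_complexSpace (n : ℕ) :
    Module.finrank ℝ (EuclideanSpace ℂ (Fin n)) = 2 * n := by
  rw [finrank_real_of_complex, finrank_euclideanSpace]; simp

theorem volume_complexBall (n : ℕ) [NeZero n] (x : EuclideanSpace ℂ (Fin n)) (r : ℝ) :
    volume (Metric.ball x r) =
      ENNReal.ofReal r ^ (2 * n) * ENNReal.ofReal (Real.pi ^ n / n.factorial) := by
  rw [InnerProductSpace.volume_ball_of_dim_even (finrank_complexSpace n), finrank_complexSpace]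

/-- Both measures are Haar, hence proportional; computing the volume of the Euclidean unit ball on
each side shows the factor is 1. -/
theorem volume_preserving_complexSpace_ofLp (n : ℕ) [NeZero n] :
    MeasurePreserving (WithLp.ofLp : EuclideanSpace ℂ (Fin n) → Fin n → ℂ) := by
  let e : EuclideanSpace ℂ (Fin n) ≃L[ℝ] (Fin n → ℂ) := PiLp.continuousLinearEquiv 2 ℝ _
  have hmeas : Measurable (WithLp.ofLp : EuclideanSpace ℂ (Fin n) → Fin n → ℂ) :=
    WithLp.measurable_ofLp _ _
  refine ⟨hmeas, ?_⟩
  have hH : (Measure.map e volume).IsAddHaarMeasure := inferInstance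
  have h1 := Measure.isAddLeftInvariant_eq_smul (Measure.map e volume) (volume : Measure (Fin n → ℂ))
  set c := Measure.addHaarScalarFactor (Measure.map e volume) (volume : Measure (Fin n → ℂ))
  have hball : WithLp.ofLp ⁻¹' {x : Fin n → ℂ | ∑ i, ‖x i‖ ^ (2 : ℝ) < 1} =
      Metric.ball (0 : EuclideanSpace ℂ (Fin n)) 1 := by
    ext x
    rw [mem_ball_zero_iff, EuclideanSpace.norm_eq, Real.sqrt_lt' one_pos]
    simp
  have hvol : volume {x : Fin n → ℂ | ∑ i, ‖x i‖ ^ (2 : ℝ) < 1} =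
      ENNReal.ofReal (Real.pi ^ n / n.factorial) := by
    rw [Complex.volume_sum_rpow_lt_one _ one_le_two]
    have : (2 : ℝ) * (Fintype.card (Fin n)) / 2 + 1 = n + 1 := by simp
    rw [this, Real.Gamma_nat_eq_factorial]
    norm_num
  have hms : MeasurableSet {x : Fin n → ℂ | ∑ i, ‖x i‖ ^ (2 : ℝ) < 1} := by
    refine measurableSet_lt ?_ measurable_const
    fun_prop
  have h2 : Measure.map e volume {x : Fin n → ℂ | ∑ i, ‖x i‖ ^ (2 : ℝ) < 1} =
      ENNReal.ofReal (Real.pi ^ n / n.factorial) := by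
    rw [Measure.map_apply e.continuous.measurable hms]
    change volume (WithLp.ofLp ⁻¹' _) = _
    rw [hball, volume_complexBall]
    simp
  rw [h1, Measure.smul_apply, hvol] at h2
  have hpos : (0 : ℝ) < Real.pi ^ n / n.factorial := by positivity
  have hc : c = 1 := by
    have h3 : (c : ENNReal) * ENNReal.ofReal (Real.pi ^ n / n.factorial) =
        1 * ENNReal.ofReal (Real.pi ^ n / n.factorial) := by rw [one_mul]; exact h2
    have h4 := (ENNReal.mul_left_inj (ENNReal.ofReal_pos.2 hpos).ne' ENNReal.ofReal_ne_top).1 h3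
    exact_mod_cast h4
  rw [hc, one_smul] at h1
  exact h1

/-- The fundamental parallelepiped of `ℤ[ω]ⁿ`. -/
def parallelepiped (n : ℕ) : Set (EuclideanSpace ℂ (Fin n)) := {x | ∀ i, x i ∈ parallelogram}

theorem parallelepiped_eq (n : ℕ) :
    parallelepiped n = WithLp.ofLp ⁻¹' (Set.univ.pi fun _ => parallelogram) := by
  ext x; simp [parallelepiped]

theorem measurableSet_parallelepiped (n : ℕ) : MeasurableSet (parallelepiped n) := by
  rw [parallelepiped_eq]
  exact WithLp.measurable_ofLp _ _
    (MeasurableSet.univ_pi fun _ => measurableSet_parallelogram)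

theorem volume_parallelepiped (n : ℕ) [NeZero n] :
    volume (parallelepiped n) = ENNReal.ofReal ((√3 / 2) ^ n) := by
  rw [parallelepiped_eq, (volume_preserving_complexSpace_ofLp n).measure_preimage
    (MeasurableSet.univ_pi fun _ => measurableSet_parallelogram).nullMeasurableSet, volume_pi_pi]
  rw [ENNReal.ofReal_pow (by positivity)]
  simp [volume_parallelogram]

theorem norm_sq_le_of_mem_parallelepiped {n : ℕ} {x : EuclideanSpace ℂ (Fin n)}
    (hx : x ∈ parallelepiped n) : ‖x‖ ^ 2 ≤ n := by
  rw [EuclideanSpace.norm_sq_eq]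
  calc ∑ i, ‖x i‖ ^ 2 ≤ ∑ _i : Fin n, (1 : ℝ) :=
        Finset.sum_le_sum fun i _ => norm_sq_le_one_of_mem_parallelogram (hx i)
    _ = n := by simp

/-- Multiplication by c is a phase, which is a real isometry, followed by the real dilation ‖c‖ in
dimension 2n. -/
theorem volume_preimage_mul {n : ℕ} (c : ℂ) (hc : c ≠ 0) (s : Set (EuclideanSpace ℂ (Fin n))) :
    volume ((fun x => c • x) ⁻¹' s) = ENNReal.ofReal ((‖c‖ ^ (2 * n))⁻¹) * volume s := by
  have hc' : ‖c‖ ≠ 0 := by simpa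
  let u : ℂ := c / ‖c‖
  have hu : ‖u‖ = 1 := by simp [u, hc']
  let f : EuclideanSpace ℂ (Fin n) ≃ₗᵢ[ℝ] EuclideanSpace ℂ (Fin n) :=
    { toLinearEquiv := (LinearEquiv.smulOfNeZero ℂ _ u (by intro h; simp [h] at hu)).restrictScalars ℝ
      norm_map' := fun x => by
        change ‖u • x‖ = ‖x‖
        rw [norm_smul, hu, one_mul] }
  have hset : (fun x => c • x) ⁻¹' s = f ⁻¹' ((fun x => ‖c‖ • x) ⁻¹' s) := by
    ext x
    have : ‖c‖ • f x = c • x := by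
      change ‖c‖ • (u • x) = c • x
      rw [← Complex.coe_smul, smul_smul]
      congr 1
      simp only [u]
      exact mul_div_cancel₀ _ (by exact_mod_cast hc')
    simp [this]
  have hf : MeasurePreserving f := f.measurePreserving
  rw [hset, hf.measure_preimage_emb f.toHomeomorph.measurableEmbedding,
    Measure.addHaar_preimage_smul _ hc', finrank_complexSpace, abs_of_nonneg (by positivity)]

/-! ### Voronoi regions of discrete subgroups -/

section Voronoi

variable {E : Type*} [NormedAddCommGroup E]

theorem isClosed_voronoiRegion (Λ : AddSubgroup E) : IsClosed (voronoiRegion Λ) := by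
  have : voronoiRegion Λ = ⋂ v ∈ Λ, {x | ‖x‖ ≤ ‖x - v‖} := by
    ext x; simp [voronoiRegion]
  rw [this]
  exact isClosed_biInter fun v _ => isClosed_le (by fun_prop) (by fun_prop)

theorem infDist_eq_norm_of_mem_voronoiRegion {Λ : AddSubgroup E} {x : E}
    (hx : x ∈ voronoiRegion Λ) : Metric.infDist x (Λ : Set E) = ‖x‖ := by
  refine le_antisymm ?_ ?_
  · simpa using Metric.infDist_le_dist_of_mem (x := x) Λ.zero_mem
  · refine (Metric.le_infDist ⟨0, Λ.zero_mem⟩).2 fun v hv => ?_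
    rw [dist_eq_norm]
    exact hx v hv

theorem infDist_add_of_mem {Λ : AddSubgroup E} {v : E} (hv : v ∈ Λ) (x : E) :
    Metric.infDist (v + x) (Λ : Set E) = Metric.infDist x (Λ : Set E) := by
  have key : ∀ w ∈ Λ, ∀ y : E, Metric.infDist (w + y) (Λ : Set E) ≤ Metric.infDist y (Λ : Set E) := by
    intro w hw y
    refine (Metric.le_infDist ⟨0, Λ.zero_mem⟩).2 fun u hu => ?_
    have := Metric.infDist_le_dist_of_mem (x := w + y) (Λ.add_mem hw hu)
    rwa [dist_add_left] at this
  refine le_antisymm (key v hv x) ?_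
  simpa using key (-v) (Λ.neg_mem hv) (v + x)

variable [InnerProductSpace ℝ E] [FiniteDimensional ℝ E]

theorem exists_sub_mem_voronoiRegion (Λ : AddSubgroup E) [DiscreteTopology Λ] (x : E) :
    ∃ v ∈ Λ, x - v ∈ voronoiRegion Λ := by
  have hc : IsClosed (Λ : Set E) := AddSubgroup.isClosed_of_discrete
  have : ProperSpace E := FiniteDimensional.proper_real E
  obtain ⟨v, hv, h⟩ := hc.exists_infDist_eq_dist ⟨0, Λ.zero_mem⟩ x
  refine ⟨v, hv, fun w hw => ?_⟩
  have := Metric.infDist_le_dist_of_mem (x := x) (Λ.add_mem hv hw)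
  rw [h, dist_eq_norm, dist_eq_norm] at this
  rwa [sub_sub]

variable [MeasurableSpace E] [BorelSpace E]

/-- A nearest lattice point exists, so the translates cover. A point shared by the region and its
translate by g ≠ 0 is equidistant from 0 and g, so overlaps lie in a perpendicular bisector, which
is null. -/
theorem isAddFundamentalDomain_voronoiRegion (Λ : AddSubgroup E) [DiscreteTopology Λ]
    [Countable Λ] : IsAddFundamentalDomain Λ (voronoiRegion Λ) := by
  refine ⟨(isClosed_voronoiRegion Λ).measurableSet.nullMeasurableSet, .of_forall fun x => ?_, ?_⟩
  · obtain ⟨v, hv, h⟩ := exists_sub_mem_voronoiRegion Λ x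
    refine ⟨⟨-v, Λ.neg_mem hv⟩, ?_⟩
    change -v + x ∈ _
    rwa [neg_add_eq_sub]
  · refine MeasureTheory.Measure.pairwise_aedisjoint_of_aedisjoint_forall_ne_zero (fun g hg => ?_)
      fun g => (measurePreserving_vadd g volume).quasiMeasurePreserving
    have hg' : (0 : E) ≠ g := fun h => hg (Subtype.ext h.symm)
    refine measure_mono_null ?_ (Measure.addHaar_affineSubspace volume
      (AffineSubspace.perpBisector (0 : E) (g : E)) (by simpa using hg'))
    rintro y ⟨⟨z, hz, rfl⟩, hy⟩
    change (g : E) + z ∈ voronoiRegion Λ at hy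
    change (g : E) + z ∈ AffineSubspace.perpBisector (0 : E) (g : E)
    rw [AffineSubspace.mem_perpBisector_iff_dist_eq, dist_eq_norm, dist_eq_norm]
    have h1 := hy g g.2
    have h2 := hz (-g) (Λ.neg_mem g.2)
    simp only [add_sub_cancel_left, sub_neg_eq_add, sub_zero] at h1 h2 ⊢
    rw [add_comm z] at h2
    exact le_antisymm h1 h2

/-- Unfold the integral of the indicator of D ∩ S over the fundamental domain: each orbit inside S
meets D exactly N times, every other orbit not at all. This carries both volumes and densities of
periodic sets from D to the Voronoi region. -/
theorem volume_inter_eq_mul_voronoiRegion (Λ : AddSubgroup E) [DiscreteTopology Λ] [Countable Λ]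
    {D S : Set E} (hD : MeasurableSet D) (hS : MeasurableSet S)
    (hinv : ∀ v ∈ Λ, ∀ x, v + x ∈ S ↔ x ∈ S) {N : ℕ}
    (hN : ∀ x, {v : Λ | (v : E) + x ∈ D}.encard = N) :
    volume (D ∩ S) = N * volume (voronoiRegion Λ ∩ S) := by
  have hF := isAddFundamentalDomain_voronoiRegion Λ
  have h := hF.lintegral_eq_tsum'' ((D ∩ S).indicator 1)
  rw [lintegral_indicator_one (hD.inter hS)] at h
  have hpt : ∀ x, ∑' v : Λ, (D ∩ S).indicator (1 : E → ENNReal) (v +ᵥ x) =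
      N * S.indicator (1 : E → ENNReal) x := by
    intro x
    by_cases hx : x ∈ S
    · have h1 : ∀ v : Λ, (D ∩ S).indicator (1 : E → ENNReal) (v +ᵥ x) =
          {v : Λ | (v : E) + x ∈ D}.indicator 1 v := by
        intro v
        have hv : v +ᵥ x ∈ S := (hinv v v.2 x).2 hx
        by_cases hd : (v : E) + x ∈ D
        · rw [Set.indicator_of_mem (show v +ᵥ x ∈ D ∩ S from ⟨hd, hv⟩), Set.indicator_of_mem (by exact hd)]
          rfl
        · rw [Set.indicator_of_notMem (fun h => hd h.1), Set.indicator_of_notMem (by exact hd)]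
      simp_rw [h1]
      rw [← tsum_subtype, Pi.one_def, ENNReal.tsum_set_one, hN]
      simp [hx]
    · have h1 : ∀ v : Λ, (D ∩ S).indicator (1 : E → ENNReal) (v +ᵥ x) = 0 := by
        intro v
        exact Set.indicator_of_notMem (fun h => hx ((hinv v v.2 x).1 h.2)) _
      simp [h1, hx]
  rw [h, ← lintegral_tsum, lintegral_congr hpt, lintegral_const_mul _ (measurable_one.indicator hS),
    lintegral_indicator_one hS, Measure.restrict_apply hS, Set.inter_comm]
  intro v
  exact ((measurable_one.indicator (hD.inter hS)).comp (measurable_const_vadd v)).aemeasurable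

end Voronoi

/-! ### Counting matrices over a finite field -/

section Counting

open Finset Matrix

/-- All fibres of a surjective homomorphism have the same size; in other words, the image of a
uniform element is uniform. -/
theorem card_filter_map_mem_mul_card {M H : Type*} [AddGroup M] [Fintype M] [AddGroup H]
    [Fintype H] [DecidableEq H] (f : M →+ H) (hf : Function.Surjective f) (T : Finset H) :
    #{a | f a ∈ T} * Fintype.card H = #T * Fintype.card M := by
  have hfib : ∀ h : H, #{a | f a = h} = #{a | f a = 0} := fun h =>
    AddMonoidHom.card_fiber_eq_of_mem_range f (hf h) (hf 0)
  have key : ∀ T : Finset H, #{a | f a ∈ T} = #T * #{a | f a = 0} := by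
    intro T
    rw [card_eq_sum_card_fiberwise (f := f) (t := T) (fun a ha => by simpa using ha)]
    rw [sum_congr rfl (g := fun _ => #{a | f a = 0}), sum_const, smul_eq_mul]
    intro h hh
    rw [← hfib h, filter_filter]
    congr 1
    ext a
    simp only [mem_filter, mem_univ, true_and]
    exact ⟨fun h => h.2, fun h => ⟨h ▸ hh, h⟩⟩
  have huniv := key univ
  simp only [mem_univ, filter_true] at huniv
  rw [card_univ, card_univ] at huniv
  rw [key, huniv]
  ring

/-- Chebyshev's inequality for the number of occurring events, for a family of pairwise
independent events of equal probability `p` in a finite uniform probability space. -/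
theorem card_forall_not_mul_le {M Y : Type*} [Fintype M] [DecidableEq Y] (Ys : Finset Y)
    (R : M → Y → Prop) [∀ a y, Decidable (R a y)]
    [∀ a, Decidable (∀ y ∈ Ys, ¬ R a y)] (p : ℝ) (hp : 0 ≤ p)
    (h1 : ∀ y ∈ Ys, (#{a | R a y} : ℝ) = p * Fintype.card M)
    (h2 : ∀ y ∈ Ys, ∀ z ∈ Ys, y ≠ z → (#{a | R a y ∧ R a z} : ℝ) = p ^ 2 * Fintype.card M) :
    (#{a | ∀ y ∈ Ys, ¬ R a y} : ℝ) * (#Ys * p) ≤ Fintype.card M := by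
  set m := (Fintype.card M : ℝ) with hm
  have hm0 : 0 ≤ m := by positivity
  set μ : ℝ := #Ys * p with hμ
  have hμ0 : 0 ≤ μ := by positivity
  let I : M → Y → ℝ := fun a y => if R a y then 1 else 0
  let X : M → ℝ := fun a => ∑ y ∈ Ys, I a y
  have hI : ∀ y ∈ Ys, ∑ a, I a y = p * m := by
    intro y hy
    rw [← h1 y hy]
    simp [I]
  have hX1 : ∑ a, X a = μ * m := by
    simp only [X]
    rw [sum_comm, sum_congr rfl hI, sum_const, nsmul_eq_mul, hμ]
    ring
  have hII : ∀ y ∈ Ys, ∀ z ∈ Ys, ∑ a, I a y * I a z ≤ p ^ 2 * m + if y = z then p * m else 0 := by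
    intro y hy z hz
    by_cases hyz : y = z
    · subst hyz
      have : ∀ a, I a y * I a y = I a y := by intro a; simp [I]
      simp only [this, hI y hy, if_true]
      nlinarith [mul_nonneg (sq_nonneg p) hm0]
    · simp only [hyz, if_false, add_zero]
      rw [← h2 y hy z hz hyz]
      refine le_of_eq ?_
      simp only [I, ← ite_and, mul_ite, mul_one, mul_zero]
      simp only [sum_boole]
      congr 2
      ext a
      simp [and_comm]
  have hX2 : ∑ a, X a ^ 2 ≤ μ ^ 2 * m + μ * m := by
    have : ∀ a, X a ^ 2 = ∑ y ∈ Ys, ∑ z ∈ Ys, I a y * I a z := by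
      intro a; simp only [X]; rw [sq, sum_mul_sum]
    simp only [this]
    rw [sum_comm, sum_congr rfl (fun y _ => sum_comm)]
    calc ∑ y ∈ Ys, ∑ z ∈ Ys, ∑ a, I a y * I a z
        ≤ ∑ y ∈ Ys, ∑ z ∈ Ys, (p ^ 2 * m + if y = z then p * m else 0) :=
          sum_le_sum fun y hy => sum_le_sum fun z hz => hII y hy z hz
      _ = ∑ y ∈ Ys, (#Ys * (p ^ 2 * m) + p * m) := by
          refine sum_congr rfl fun y hy => ?_
          rw [sum_add_distrib, sum_const, nsmul_eq_mul, sum_ite_eq, if_pos hy]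
      _ = μ ^ 2 * m + μ * m := by
          rw [sum_const, nsmul_eq_mul, hμ]; ring
  have hvar : ∑ a, (X a - μ) ^ 2 ≤ μ * m := by
    have : ∀ a, (X a - μ) ^ 2 = X a ^ 2 - 2 * μ * X a + μ ^ 2 := by intro a; ring
    simp only [this]
    rw [sum_add_distrib, sum_sub_distrib, ← mul_sum, hX1, sum_const, card_univ, nsmul_eq_mul, ← hm]
    nlinarith
  -- If no event occurs then X = 0, which contributes the full μ² to the variance sum.
  have hbad : (#{a | ∀ y ∈ Ys, ¬ R a y} : ℝ) * μ ^ 2 ≤ ∑ a, (X a - μ) ^ 2 := by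
    rw [← nsmul_eq_mul, ← sum_const]
    rw [sum_congr rfl (g := fun a => (X a - μ) ^ 2)]
    · exact sum_le_sum_of_subset_of_nonneg (subset_univ _) fun a _ _ => sq_nonneg (X a - μ)
    intro a ha
    have ha' : ∀ y ∈ Ys, ¬ R a y := by simpa using ha
    have : X a = 0 := sum_eq_zero fun y hy => by simp [I, ha' y hy]
    rw [this]; ring
  rcases hμ0.eq_or_lt with h0 | hpos
  · rw [← h0, mul_zero]; exact hm0
  · have := hbad.trans hvar
    rw [sq, ← mul_assoc, mul_comm μ m] at this
    exact le_of_mul_le_mul_right this hpos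

variable {F : Type*} [Field F] [Fintype F] [DecidableEq F] {n k : ℕ}

/-- The evaluation map `A ↦ A y` on matrices. -/
def mulVecHom (n : ℕ) (y : Fin k → F) : Matrix (Fin n) (Fin k) F →+ (Fin n → F) where
  toFun A := A *ᵥ y
  map_zero' := zero_mulVec y
  map_add' A B := add_mulVec A B y

omit [Fintype F] [DecidableEq F] in
theorem mulVecHom_surjective {y : Fin k → F} (hy : y ≠ 0) :
    Function.Surjective (mulVecHom n y) := by
  obtain ⟨j, hj⟩ := Function.ne_iff.1 hy
  intro c
  refine ⟨Matrix.of fun i => Pi.single j (c i / y j), ?_⟩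
  ext i
  change (fun l => (Pi.single j (c i / y j) : Fin k → F) l) ⬝ᵥ y = c i
  rw [single_dotProduct]
  exact div_mul_cancel₀ _ hj

omit [Fintype F] [DecidableEq F] in
-- Distinct messages that agree on a nonzero coordinate are linearly independent, so each row can
-- hit any prescribed pair of values using only column j and a column l where they differ. This is
-- the source of pairwise independence.
theorem mulVecHom_prod_surjective {y z : Fin k → F} {j : Fin k} (hy : y j = 1) (hz : z j = 1)
    (hyz : y ≠ z) : Function.Surjective ((mulVecHom n y).prod (mulVecHom n z)) := by
  obtain ⟨l, hl⟩ := Function.ne_iff.1 hyz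
  have hl' : y l - z l ≠ 0 := sub_ne_zero.2 hl
  rintro ⟨c, d⟩
  let b : Fin n → F := fun i => (c i - d i) / (y l - z l)
  have hb : ∀ i, b i * (y l - z l) = c i - d i := fun i => div_mul_cancel₀ _ hl'
  refine ⟨Matrix.of fun i => Pi.single j (c i - b i * y l) + Pi.single l (b i), ?_⟩
  refine Prod.ext ?_ ?_
  · ext i
    change (Pi.single j (c i - b i * y l) + Pi.single l (b i)) ⬝ᵥ y = c i
    rw [add_dotProduct, single_dotProduct, single_dotProduct, hy]
    ring
  · ext i
    change (Pi.single j (c i - b i * y l) + Pi.single l (b i)) ⬝ᵥ z = d i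
    rw [add_dotProduct, single_dotProduct, single_dotProduct, hz]
    linear_combination -(hb i)

/-- Union bound over nonzero messages, each of which a uniform matrix kills with probability q^(-n).
-/
theorem card_not_injective_mul_le :
    #{A : Matrix (Fin n) (Fin k) F | ∃ y, y ≠ 0 ∧ A *ᵥ y = 0} * Fintype.card F ^ n ≤
      Fintype.card F ^ k * Fintype.card (Matrix (Fin n) (Fin k) F) := by
  have hsub : ({A : Matrix (Fin n) (Fin k) F | ∃ y, y ≠ 0 ∧ A *ᵥ y = 0} : Finset _) ⊆
      ({y : Fin k → F | y ≠ 0} : Finset _).biUnion fun y => {A | mulVecHom n y A ∈ ({0} : Finset _)} := by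
    intro A hA
    simp only [mem_filter, mem_univ, true_and, mem_biUnion, mem_singleton] at hA ⊢
    exact hA
  calc _ ≤ (∑ y ∈ ({y : Fin k → F | y ≠ 0} : Finset _),
          #{A | mulVecHom n y A ∈ ({0} : Finset _)}) * Fintype.card F ^ n :=
        Nat.mul_le_mul_right _ ((card_le_card hsub).trans card_biUnion_le)
    _ = ∑ y ∈ ({y : Fin k → F | y ≠ 0} : Finset _), Fintype.card (Matrix (Fin n) (Fin k) F) := by
        rw [sum_mul]
        refine sum_congr rfl fun y hy => ?_
        have := card_filter_map_mem_mul_card (mulVecHom n y)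
          (mulVecHom_surjective (by simpa using hy)) {0}
        simpa using this
    _ ≤ _ := by
        rw [sum_const, smul_eq_mul]
        refine Nat.mul_le_mul_right _ ((card_le_univ _).trans (by simp))

/-- A random `k`-dimensional code misses a set `T` of words with probability at most
`q ^ (n + 1) / (q ^ k |T|)`. -/
theorem card_code_misses_mul_le [NeZero k] (T : Finset (Fin n → F)) :
    (#{A : Matrix (Fin n) (Fin k) F | ∀ y, A *ᵥ y ∉ T} : ℝ) * (Fintype.card F ^ k * #T) ≤
      Fintype.card F * Fintype.card F ^ n * Fintype.card (Matrix (Fin n) (Fin k) F) := by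
  set q := (Fintype.card F : ℝ) with hq
  have hq0 : 0 < q := by rw [hq]; exact_mod_cast Fintype.card_pos
  -- Normalizing one coordinate makes the messages pairwise independent; it keeps a fraction 1/q of
  -- them, which is the extra factor q in the bound.
  set Ys : Finset (Fin k → F) := {y | y 0 = 1} with hYs
  have hcard : (#Ys : ℝ) * q = q ^ k := by
    have := card_filter_map_mem_mul_card (Pi.evalAddMonoidHom (fun _ : Fin k => F) 0)
      (Function.surjective_eval 0) {1}
    simp only [mem_singleton, Pi.evalAddMonoidHom_apply, card_singleton, one_mul, Fintype.card_fun,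
      Fintype.card_fin] at this
    rw [hq]
    exact_mod_cast this
  have key := card_forall_not_mul_le (M := Matrix (Fin n) (Fin k) F) Ys (fun A y => A *ᵥ y ∈ T)
    (#T / q ^ n) (by positivity) (fun y hy => ?_) (fun y hy z hz hyz => ?_)
  · have hle : (#{A : Matrix (Fin n) (Fin k) F | ∀ y, A *ᵥ y ∉ T} : ℝ) ≤
        #{A : Matrix (Fin n) (Fin k) F | ∀ y ∈ Ys, A *ᵥ y ∉ T} := by
      exact_mod_cast card_le_card fun A hA => by
        simp only [mem_filter, mem_univ, true_and] at hA ⊢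
        exact fun y _ => hA y
    have hnn : 0 ≤ (#Ys : ℝ) * (#T / q ^ n) := by positivity
    have h3 := (mul_le_mul_of_nonneg_right hle hnn).trans key
    rw [← hcard]
    generalize (#{A : Matrix (Fin n) (Fin k) F | ∀ y, A *ᵥ y ∉ T} : ℝ) = b at h3 ⊢
    have hqn : 0 < q ^ n := by positivity
    calc b * (#Ys * q * #T) = b * (#Ys * (#T / q ^ n)) * (q * q ^ n) := by field_simp
      _ ≤ Fintype.card (Matrix (Fin n) (Fin k) F) * (q * q ^ n) :=
          mul_le_mul_of_nonneg_right h3 (by positivity)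
      _ = _ := by ring
  · have hy1 : y 0 = 1 := by simpa [hYs] using hy
    have hy0 : y ≠ 0 := by rintro rfl; simp at hy1
    have := card_filter_map_mem_mul_card (mulVecHom n y) (mulVecHom_surjective hy0) T
    rw [Fintype.card_fun, Fintype.card_fin] at this
    have h' : (#{A : Matrix (Fin n) (Fin k) F | A *ᵥ y ∈ T} : ℝ) * q ^ n =
        #T * Fintype.card (Matrix (Fin n) (Fin k) F) := by rw [hq]; exact_mod_cast this
    rw [div_mul_eq_mul_div, eq_div_iff (by positivity), h']
  · have hy1 : y 0 = 1 := by simpa [hYs] using hy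
    have hz1 : z 0 = 1 := by simpa [hYs] using hz
    have := card_filter_map_mem_mul_card _ (mulVecHom_prod_surjective (n := n) hy1 hz1 hyz) (T ×ˢ T)
    rw [Fintype.card_prod, Fintype.card_fun, Fintype.card_fin, card_product] at this
    have h' : (#{A : Matrix (Fin n) (Fin k) F | A *ᵥ y ∈ T ∧ A *ᵥ z ∈ T} : ℝ) * (q ^ n * q ^ n) =
        #T * #T * Fintype.card (Matrix (Fin n) (Fin k) F) := by
      rw [hq]
      norm_cast
      rw [← this]
      congr 2
      ext A
      simp [mulVecHom]
    rw [div_pow, div_mul_eq_mul_div, eq_div_iff (by positivity), sq, sq, h']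

end Counting

/-! ### The geometry of Construction A -/

section ConstructionA

/-- A vector of Eisenstein integers, as a point of `ℂⁿ`. -/
def toComplexSpace {n : ℕ} (u : Fin n → eisensteinIntegers) : EuclideanSpace ℂ (Fin n) :=
  WithLp.toLp 2 fun i => (u i : ℂ)

@[simp]
theorem toComplexSpace_apply {n : ℕ} (u : Fin n → eisensteinIntegers) (i : Fin n) :
    toComplexSpace u i = u i := rfl

theorem one_le_norm_toComplexSpace {n : ℕ} {u : Fin n → eisensteinIntegers} (hu : u ≠ 0) :
    1 ≤ ‖toComplexSpace u‖ := by
  obtain ⟨i, hi⟩ := Function.ne_iff.1 hu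
  exact (one_le_norm_of_ne_zero (u i) hi).trans (PiLp.norm_apply_le (toComplexSpace u) i)

theorem exists_sub_mem_parallelepiped {n : ℕ} (x : EuclideanSpace ℂ (Fin n)) :
    ∃ u : Fin n → eisensteinIntegers, x - toComplexSpace u ∈ parallelepiped n := by
  choose u hu using fun i => exists_sub_mem_parallelogram (x i)
  exact ⟨u, hu⟩

theorem eq_of_sub_mem_parallelepiped {n : ℕ} {x : EuclideanSpace ℂ (Fin n)}
    {u v : Fin n → eisensteinIntegers} (hu : x - toComplexSpace u ∈ parallelepiped n)
    (hv : x - toComplexSpace v ∈ parallelepiped n) : u = v :=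
  funext fun i => eq_of_sub_mem_parallelogram (hu i) (hv i)

variable {n k q : ℕ} {ϱ : eisensteinIntegers}
  (σ : (eisensteinIntegers ⧸ Ideal.span {ϱ}) ≃+* ZMod q)

theorem labeling_surjective : Function.Surjective (labeling σ) :=
  σ.surjective.comp Ideal.Quotient.mk_surjective

theorem labeling_eq_iff (u v : eisensteinIntegers) :
    labeling σ u = labeling σ v ↔ ∃ w, u = v + ϱ * w := by
  change σ _ = σ _ ↔ _
  rw [σ.injective.eq_iff, Ideal.Quotient.eq, Ideal.mem_span_singleton]
  refine exists_congr fun w => sub_eq_iff_eq_add'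

theorem mem_constructionA_iff (A : Matrix (Fin n) (Fin k) (ZMod q))
    (x : EuclideanSpace ℂ (Fin n)) :
    x ∈ constructionA ϱ σ A ↔ ∃ ℓ : Fin n → eisensteinIntegers,
      (∃ y, A.mulVec y = fun i => labeling σ (ℓ i)) ∧ x = (ϱ : ℂ)⁻¹ • toComplexSpace ℓ := by
  refine exists_congr fun ℓ => and_congr Iff.rfl ⟨fun h => ?_, fun h i => ?_⟩
  · ext i; exact h i
  · rw [h]; rfl

/-- The labeling has kernel ϱℤ[ω], which becomes ℤ[ω] after scaling by ϱ⁻¹. -/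
theorem toComplexSpace_eq_of_labeling_eq (hϱ : (ϱ : ℂ) ≠ 0) {ℓ m : Fin n → eisensteinIntegers}
    (h : ∀ i, labeling σ (ℓ i) = labeling σ (m i)) :
    ∃ w : Fin n → eisensteinIntegers,
      (ϱ : ℂ)⁻¹ • toComplexSpace ℓ = (ϱ : ℂ)⁻¹ • toComplexSpace m + toComplexSpace w := by
  choose w hw using fun i => (labeling_eq_iff σ (ℓ i) (m i)).1 (h i)
  refine ⟨w, ?_⟩
  ext i
  simp [hw i, mul_add, hϱ]

theorem toComplexSpace_mem_constructionA (hϱ : (ϱ : ℂ) ≠ 0)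
    (A : Matrix (Fin n) (Fin k) (ZMod q)) (u : Fin n → eisensteinIntegers) :
    toComplexSpace u ∈ constructionA ϱ σ A := by
  refine (mem_constructionA_iff σ A _).2 ⟨fun i => ϱ * u i, ⟨0, ?_⟩, ?_⟩
  · ext i
    have := (labeling_eq_iff σ (ϱ * u i) 0).2 ⟨u i, by rw [zero_add]⟩
    rw [this]; simp
  · ext i; simp [hϱ]

/-- The sublattice ℤ[ω]ⁿ already has a point within √n of any given point, whatever the code is. -/
theorem norm_sq_le_of_mem_voronoiRegion (hϱ : (ϱ : ℂ) ≠ 0)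
    (A : Matrix (Fin n) (Fin k) (ZMod q)) {x : EuclideanSpace ℂ (Fin n)}
    (hx : x ∈ voronoiRegion (constructionA ϱ σ A)) : ‖x‖ ^ 2 ≤ n := by
  obtain ⟨u, hu⟩ := exists_sub_mem_parallelepiped x
  have h := hx _ (toComplexSpace_mem_constructionA σ hϱ A u)
  exact (pow_le_pow_left₀ (norm_nonneg _) h 2).trans (norm_sq_le_of_mem_parallelepiped hu)

instance (A : Matrix (Fin n) (Fin k) (ZMod q)) : Countable (constructionA ϱ σ A) := by
  refine Set.Countable.to_subtype (s := (constructionA ϱ σ A : Set (EuclideanSpace ℂ (Fin n))))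
    ((Set.countable_range fun ℓ : Fin n → eisensteinIntegers =>
      (ϱ : ℂ)⁻¹ • toComplexSpace ℓ).mono fun x hx => ?_)
  obtain ⟨ℓ, -, rfl⟩ := (mem_constructionA_iff σ A x).1 hx
  exact ⟨ℓ, rfl⟩

theorem discreteTopology_constructionA (hϱ : (ϱ : ℂ) ≠ 0)
    (A : Matrix (Fin n) (Fin k) (ZMod q)) : DiscreteTopology (constructionA ϱ σ A) := by
  refine .of_forall_le_norm (r := ‖(ϱ : ℂ)⁻¹‖) (by simpa using hϱ) fun ⟨x, hx⟩ hx0 => ?_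
  obtain ⟨ℓ, -, rfl⟩ := (mem_constructionA_iff σ A x).1 hx
  change ‖(ϱ : ℂ)⁻¹‖ ≤ ‖(ϱ : ℂ)⁻¹ • toComplexSpace ℓ‖
  rw [norm_smul]
  refine le_mul_of_one_le_right (norm_nonneg _) (one_le_norm_toComplexSpace ?_)
  rintro rfl
  refine hx0 (Subtype.ext ?_)
  ext i
  simp

/-- A full-rank Construction A lattice has index `q ^ k` over `ℤ[ω]ⁿ`. -/
theorem encard_add_mem_parallelepiped [NeZero q] (hϱ : (ϱ : ℂ) ≠ 0)
    {A : Matrix (Fin n) (Fin k) (ZMod q)} (hA : Function.Injective A.mulVec)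
    (x : EuclideanSpace ℂ (Fin n)) :
    {v : constructionA ϱ σ A | (v : EuclideanSpace ℂ (Fin n)) + x ∈ parallelepiped n}.encard =
      (q ^ k : ℕ) := by
  have hex : ∀ y : Fin k → ZMod q, ∃ v : constructionA ϱ σ A,
      (v : EuclideanSpace ℂ (Fin n)) + x ∈ parallelepiped n ∧
      ∃ ℓ : Fin n → eisensteinIntegers, (A.mulVec y = fun i => labeling σ (ℓ i)) ∧
        (v : EuclideanSpace ℂ (Fin n)) = (ϱ : ℂ)⁻¹ • toComplexSpace ℓ := by
    intro y
    choose m hm using fun i => labeling_surjective σ (A.mulVec y i)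
    obtain ⟨u, hu⟩ := exists_sub_mem_parallelepiped ((ϱ : ℂ)⁻¹ • toComplexSpace m + x)
    have hl : A.mulVec y = fun i => labeling σ (m i - ϱ * u i) := by
      ext i
      rw [← hm i]
      exact (labeling_eq_iff σ _ _).2 ⟨u i, by ring⟩
    have hv : (ϱ : ℂ)⁻¹ • toComplexSpace (fun i => m i - ϱ * u i) =
        (ϱ : ℂ)⁻¹ • toComplexSpace m - toComplexSpace u := by
      ext i; simp [mul_sub, hϱ]
    refine ⟨⟨_, (mem_constructionA_iff σ A _).2 ⟨_, ⟨y, hl⟩, rfl⟩⟩, ?_, _, hl, rfl⟩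
    change (ϱ : ℂ)⁻¹ • toComplexSpace (fun i => m i - ϱ * u i) + x ∈ _
    rwa [hv, sub_add_eq_add_sub]
  choose Φ hΦ ℓ hℓ hΦℓ using hex
  -- Lattice points with the same codeword differ by ℤ[ω]ⁿ, and only one translate lies in the
  -- half-open cell. Injectivity of A is needed only to separate messages.
  have huniq : ∀ (v : constructionA ϱ σ A) (y : Fin k → ZMod q) (m : Fin n → eisensteinIntegers),
      (v : EuclideanSpace ℂ (Fin n)) + x ∈ parallelepiped n →
      (A.mulVec y = fun i => labeling σ (m i)) →
      (v : EuclideanSpace ℂ (Fin n)) = (ϱ : ℂ)⁻¹ • toComplexSpace m → Φ y = v := by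
    intro v y m hv hm hvm
    obtain ⟨w, hw⟩ := toComplexSpace_eq_of_labeling_eq σ hϱ
      (fun i => congrFun ((hℓ y).symm.trans hm) i)
    rw [← hΦℓ, ← hvm] at hw
    have h1 : (Φ y : EuclideanSpace ℂ (Fin n)) + x - toComplexSpace 0 ∈ parallelepiped n := by
      have : toComplexSpace (0 : Fin n → eisensteinIntegers) = 0 := by ext i; simp
      rw [this, sub_zero]; exact hΦ y
    have h2 : (Φ y : EuclideanSpace ℂ (Fin n)) + x - toComplexSpace w ∈ parallelepiped n := by
      rw [hw, add_right_comm, add_sub_cancel_right]; exact hv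
    have h0 : w = 0 := eq_of_sub_mem_parallelepiped h2 h1
    refine Subtype.ext (hw.trans ?_)
    rw [h0]; ext i; simp
  have hinj : Function.Injective Φ := by
    intro y z hyz
    have h1 : (ϱ : ℂ)⁻¹ • toComplexSpace (ℓ y) = (ϱ : ℂ)⁻¹ • toComplexSpace (ℓ z) := by
      rw [← hΦℓ, ← hΦℓ, hyz]
    have h2 := smul_right_injective _ (inv_ne_zero hϱ) h1
    refine hA ?_
    rw [hℓ, hℓ]
    ext i
    congr 1
    exact Subtype.ext (congrFun (congrArg WithLp.ofLp h2) i)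
  have hrange : {v : constructionA ϱ σ A |
      (v : EuclideanSpace ℂ (Fin n)) + x ∈ parallelepiped n} = Set.range Φ := by
    ext v
    refine ⟨fun hv => ?_, ?_⟩
    · obtain ⟨m, ⟨y, hy⟩, hm⟩ := (mem_constructionA_iff σ A v).1 v.2
      exact ⟨y, huniq v y m hv hy hm⟩
    · rintro ⟨y, rfl⟩
      exact hΦ y
  rw [hrange, ← Set.image_univ, hinj.encard_image, Set.encard_univ, ENat.card_eq_coe_fintype_card]
  simp [ZMod.card]

theorem volume_parallelepiped_inter [NeZero q] (hϱ : (ϱ : ℂ) ≠ 0)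
    {A : Matrix (Fin n) (Fin k) (ZMod q)} (hA : Function.Injective A.mulVec)
    {S : Set (EuclideanSpace ℂ (Fin n))} (hS : MeasurableSet S)
    (hinv : ∀ v ∈ constructionA ϱ σ A, ∀ x, v + x ∈ S ↔ x ∈ S) :
    volume (parallelepiped n ∩ S) =
      (q ^ k : ℕ) * volume (voronoiRegion (constructionA ϱ σ A) ∩ S) := by
  have := discreteTopology_constructionA σ hϱ A
  exact volume_inter_eq_mul_voronoiRegion _ (measurableSet_parallelepiped n) hS hinv
    (encard_add_mem_parallelepiped σ hϱ hA)

open scoped Classical in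
/-- The labels of the points of `ϱ⁻¹ ℤ[ω]ⁿ` at distance at most `s` from `x`. -/
def nearbyLabels [NeZero q] (x : EuclideanSpace ℂ (Fin n)) (s : ℝ) : Finset (Fin n → ZMod q) :=
  {c | ∃ ℓ : Fin n → eisensteinIntegers, (fun i => labeling σ (ℓ i)) = c ∧
    ‖(ϱ : ℂ)⁻¹ • toComplexSpace ℓ - x‖ ≤ s}

theorem mulVec_notMem_nearbyLabels [NeZero q] {A : Matrix (Fin n) (Fin k) (ZMod q)}
    {x : EuclideanSpace ℂ (Fin n)} {s : ℝ}
    (h : s < Metric.infDist x (constructionA ϱ σ A : Set (EuclideanSpace ℂ (Fin n))))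
    (y : Fin k → ZMod q) : A.mulVec y ∉ nearbyLabels σ x s := by
  intro hy
  simp only [nearbyLabels, Finset.mem_filter, Finset.mem_univ, true_and] at hy
  obtain ⟨ℓ, hℓ, hd⟩ := hy
  have hmem := (mem_constructionA_iff σ A _).2 ⟨ℓ, ⟨y, hℓ.symm⟩, rfl⟩
  have := Metric.infDist_le_dist_of_mem (x := x) hmem
  rw [dist_comm, dist_eq_norm] at this
  linarith

/-- Cells of the grid ϱ⁻¹ℤ[ω]ⁿ have radius at most √(n/q), so the cells at grid points within s of x
cover the ball shrunk by that amount. Since s < 1/2, grid points in the ball have distinct labels,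
and counting labels counts cells. -/
theorem volume_ball_le_card_nearbyLabels [NeZero n] [NeZero q] (hϱq : ‖(ϱ : ℂ)‖ ^ 2 = q)
    (x : EuclideanSpace ℂ (Fin n)) {s : ℝ} (hs : s < 1 / 2) :
    volume (Metric.ball x (s - √(n / q))) ≤
      (nearbyLabels σ x s).card * ENNReal.ofReal ((√3 / 2) ^ n / q ^ n) := by
  have hq : (0 : ℝ) < q := by exact_mod_cast Nat.pos_of_ne_zero (NeZero.ne q)
  have hϱ : (ϱ : ℂ) ≠ 0 := by
    intro h; rw [h] at hϱq; simp at hϱq; exact hq.ne hϱq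
  have hex : ∀ c ∈ nearbyLabels σ x s, ∃ ℓ : Fin n → eisensteinIntegers,
      (fun i => labeling σ (ℓ i)) = c ∧ ‖(ϱ : ℂ)⁻¹ • toComplexSpace ℓ - x‖ ≤ s := by
    intro c hc
    simpa [nearbyLabels] using hc
  choose! ℓ hℓ hℓs using hex
  let cell : (Fin n → ZMod q) → Set (EuclideanSpace ℂ (Fin n)) := fun c =>
    (fun z => z + -((ϱ : ℂ)⁻¹ • toComplexSpace (ℓ c))) ⁻¹' ((fun z => (ϱ : ℂ) • z) ⁻¹' parallelepiped n)
  have hcell : ∀ c, volume (cell c) = ENNReal.ofReal ((√3 / 2) ^ n / q ^ n) := by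
    intro c
    have := measure_preimage_add_right (volume : Measure (EuclideanSpace ℂ (Fin n)))
      (-((ϱ : ℂ)⁻¹ • toComplexSpace (ℓ c))) ((fun z => (ϱ : ℂ) • z) ⁻¹' parallelepiped n)
    rw [show volume (cell c) = _ from this, volume_preimage_mul _ hϱ, volume_parallelepiped,
      ← ENNReal.ofReal_mul (by positivity), pow_mul, hϱq]
    congr 1
    exact (div_eq_inv_mul _ _).symm
  have hcover : Metric.ball x (s - √(n / q)) ⊆ ⋃ c ∈ nearbyLabels σ x s, cell c := by
    intro z hz
    rw [mem_ball_iff_norm] at hz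
    obtain ⟨m, hm⟩ := exists_sub_mem_parallelepiped ((ϱ : ℂ) • z)
    have hmz : ‖(ϱ : ℂ)⁻¹ • toComplexSpace m - z‖ ≤ √(n / q) := by
      refine Real.le_sqrt_of_sq_le ?_
      have h1 := norm_sq_le_of_mem_parallelepiped hm
      have h2 : (ϱ : ℂ) • z - toComplexSpace m = -((ϱ : ℂ) • ((ϱ : ℂ)⁻¹ • toComplexSpace m - z)) := by
        rw [smul_sub, smul_inv_smul₀ hϱ, neg_sub]
      rw [h2, norm_neg, norm_smul, mul_pow, hϱq] at h1
      rw [le_div_iff₀ hq]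
      linarith
    have hms : ‖(ϱ : ℂ)⁻¹ • toComplexSpace m - x‖ ≤ s := by
      have := norm_sub_le_norm_sub_add_norm_sub ((ϱ : ℂ)⁻¹ • toComplexSpace m) z x
      linarith
    have hc : (fun i => labeling σ (m i)) ∈ nearbyLabels σ x s := by
      simp only [nearbyLabels, Finset.mem_filter, Finset.mem_univ, true_and]
      exact ⟨m, rfl, hms⟩
    refine Set.mem_biUnion hc ?_
    obtain ⟨w, hw⟩ := toComplexSpace_eq_of_labeling_eq σ hϱ (fun i => congrFun (hℓ _ hc) i)
    -- The difference of the two grid points is a vector of ℤ[ω]ⁿ of norm at most 2s < 1.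
    have hw0 : w = 0 := by
      by_contra hne
      have h1 := one_le_norm_toComplexSpace hne
      have h2 : toComplexSpace w = ((ϱ : ℂ)⁻¹ • toComplexSpace (ℓ fun i => labeling σ (m i)) - x) -
          ((ϱ : ℂ)⁻¹ • toComplexSpace m - x) := by
        rw [hw]; abel
      rw [h2] at h1
      have h3 := norm_sub_le ((ϱ : ℂ)⁻¹ • toComplexSpace (ℓ fun i => labeling σ (m i)) - x)
        ((ϱ : ℂ)⁻¹ • toComplexSpace m - x)
      have h4 := hℓs _ hc
      linarith
    have h0 : toComplexSpace w = 0 := by rw [hw0]; ext i; simp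
    change (ϱ : ℂ) • (z + -((ϱ : ℂ)⁻¹ • toComplexSpace (ℓ fun i => labeling σ (m i)))) ∈
      parallelepiped n
    rw [← sub_eq_add_neg, hw, h0, add_zero, smul_sub, smul_inv_smul₀ hϱ]
    exact hm
  calc _ ≤ volume (⋃ c ∈ nearbyLabels σ x s, cell c) := measure_mono hcover
    _ ≤ ∑ c ∈ nearbyLabels σ x s, volume (cell c) := measure_biUnion_finset_le _ _
    _ = _ := by simp [hcell]

end ConstructionA

/-! ### Covering by a random lattice -/

section Covering

open Finset

variable {n k q : ℕ} [NeZero n] {ϱ : eisensteinIntegers}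
  (σ : (eisensteinIntegers ⧸ Ideal.span {ϱ}) ≃+* ZMod q)

open scoped Classical in
-- If x is far from the lattice, the code misses every label near x. The volume bound makes that
-- label set large, and `hr` turns the resulting miss probability into q (r / (s - √(n/q)))^(2n).
theorem card_lt_infDist_mul_le [NeZero k] [Fact q.Prime] (hϱq : ‖(ϱ : ℂ)‖ ^ 2 = q) {r : ℝ}
    (hr : (q : ℝ) ^ k * (Real.pi ^ n * r ^ (2 * n) / n.factorial) = (√3 / 2) ^ n)
    (x : EuclideanSpace ℂ (Fin n)) {s : ℝ} (hs : s < 1 / 2) (hs' : √(n / q) ≤ s) :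
    (#{A : Matrix (Fin n) (Fin k) (ZMod q) |
        s < Metric.infDist x (constructionA ϱ σ A : Set (EuclideanSpace ℂ (Fin n)))} : ℝ) *
      (s - √(n / q)) ^ (2 * n) ≤
    q * r ^ (2 * n) * Fintype.card (Matrix (Fin n) (Fin k) (ZMod q)) := by
  have hq : (0 : ℝ) < q := by exact_mod_cast Nat.pos_of_ne_zero (NeZero.ne q)
  set T := nearbyLabels σ x s
  set ε := √(n / q : ℝ)
  set m := (Fintype.card (Matrix (Fin n) (Fin k) (ZMod q)) : ℝ)
  set b := (#{A : Matrix (Fin n) (Fin k) (ZMod q) |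
        s < Metric.infDist x (constructionA ϱ σ A : Set (EuclideanSpace ℂ (Fin n)))} : ℝ)
  have hT : (s - ε) ^ (2 * n) * (Real.pi ^ n / n.factorial) ≤ #T * ((√3 / 2) ^ n / q ^ n) := by
    have h := volume_ball_le_card_nearbyLabels σ hϱq x hs
    rw [volume_complexBall, ← ENNReal.ofReal_pow (sub_nonneg.2 hs'),
      ← ENNReal.ofReal_mul (pow_nonneg (sub_nonneg.2 hs') _), ← ENNReal.ofReal_natCast,
      ← ENNReal.ofReal_mul (by positivity)] at h
    exact (ENNReal.ofReal_le_ofReal_iff (by positivity)).1 h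
  have hb : b * (q ^ k * #T) ≤ q * q ^ n * m := by
    have h := card_code_misses_mul_le (k := k) T
    rw [ZMod.card] at h
    refine le_trans (mul_le_mul_of_nonneg_right ?_ (by positivity)) h
    refine Nat.cast_le.2 (card_le_card fun A hA => ?_)
    simp only [mem_filter, mem_univ, true_and] at hA ⊢
    exact mulVec_notMem_nearbyLabels σ hA
  have hb0 : 0 ≤ b := by positivity
  have hc : 0 < (q : ℝ) ^ k * (Real.pi ^ n / n.factorial) := by positivity
  have hqn : 0 < (q : ℝ) ^ n := by positivity
  refine le_of_mul_le_mul_right ?_ hc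
  calc b * (s - ε) ^ (2 * n) * (q ^ k * (Real.pi ^ n / n.factorial))
      = b * q ^ k * ((s - ε) ^ (2 * n) * (Real.pi ^ n / n.factorial)) := by ring
    _ ≤ b * q ^ k * (#T * ((√3 / 2) ^ n / q ^ n)) :=
        mul_le_mul_of_nonneg_left hT (by positivity)
    _ = b * (q ^ k * #T) * ((√3 / 2) ^ n / q ^ n) := by ring
    _ ≤ q * q ^ n * m * ((√3 / 2) ^ n / q ^ n) :=
        mul_le_mul_of_nonneg_right hb (by positivity)
    _ = q * m * (√3 / 2) ^ n := by field_simp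
    _ = q * r ^ (2 * n) * m * (q ^ k * (Real.pi ^ n / n.factorial)) := by rw [← hr]; ring

omit [NeZero n] in
theorem measurableSet_lt_infDist (S : Set (EuclideanSpace ℂ (Fin n))) (s : ℝ) :
    MeasurableSet {x | s < Metric.infDist x S} :=
  measurableSet_lt measurable_const (Metric.continuous_infDist_pt S).measurable

open scoped Classical in
/-- Few lattices leave a fraction of more than `τ` of the space at distance greater than `s`. -/
theorem card_volume_lt_infDist_mul_le [NeZero k] [Fact q.Prime] (hϱq : ‖(ϱ : ℂ)‖ ^ 2 = q) {r : ℝ}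
    (hr : (q : ℝ) ^ k * (Real.pi ^ n * r ^ (2 * n) / n.factorial) = (√3 / 2) ^ n)
    {s : ℝ} (hs : s < 1 / 2) (hs' : √(n / q) ≤ s) (τ : ℝ) :
    (#{A : Matrix (Fin n) (Fin k) (ZMod q) |
        τ * (√3 / 2) ^ n < volume.real (parallelepiped n ∩ {x | s < Metric.infDist x
          (constructionA ϱ σ A : Set (EuclideanSpace ℂ (Fin n)))})} : ℝ) *
      (τ * (s - √(n / q)) ^ (2 * n)) ≤
    q * r ^ (2 * n) * Fintype.card (Matrix (Fin n) (Fin k) (ZMod q)) := by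
  set ε := √(n / q : ℝ)
  set m := (Fintype.card (Matrix (Fin n) (Fin k) (ZMod q)) : ℝ)
  let S : Matrix (Fin n) (Fin k) (ZMod q) → Set (EuclideanSpace ℂ (Fin n)) := fun A =>
    {x | s < Metric.infDist x (constructionA ϱ σ A : Set (EuclideanSpace ℂ (Fin n)))}
  have hS : ∀ A, MeasurableSet (S A) := fun A => measurableSet_lt_infDist _ _
  set B : Finset (Matrix (Fin n) (Fin k) (ZMod q)) :=
    {A | τ * (√3 / 2) ^ n < volume.real (parallelepiped n ∩ S A)}
  have hD : volume (parallelepiped n) ≠ ⊤ := by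
    rw [volume_parallelepiped]; exact ENNReal.ofReal_ne_top
  have : IsFiniteMeasure (volume.restrict (parallelepiped n)) :=
    isFiniteMeasure_restrict.2 hD
  have hDr : volume.real (parallelepiped n) = (√3 / 2) ^ n := by
    rw [measureReal_def, volume_parallelepiped, ENNReal.toReal_ofReal (by positivity)]
  have hv : 0 < (√3 / 2 : ℝ) ^ n := by positivity
  have h1 : (#B : ℝ) * (τ * (√3 / 2) ^ n) ≤ ∑ A, volume.real (parallelepiped n ∩ S A) := by
    rw [← nsmul_eq_mul, ← sum_const]
    calc _ ≤ ∑ A ∈ B, volume.real (parallelepiped n ∩ S A) :=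
          sum_le_sum fun A hA => (mem_filter.1 hA).2.le
      _ ≤ _ := sum_le_sum_of_subset_of_nonneg (subset_univ _) fun _ _ _ => measureReal_nonneg
  -- Exchanging the sum over matrices with the integral over x reduces the average uncovered volume
  -- to the pointwise miss bound.
  have h2 : ∑ A, volume.real (parallelepiped n ∩ S A) =
      ∫ x in parallelepiped n, ∑ A, (S A).indicator (fun _ => (1 : ℝ)) x := by
    rw [integral_finsetSum _ fun A _ => (integrable_const (1 : ℝ)).indicator (hS A)]
    refine sum_congr rfl fun A _ => ?_
    rw [integral_indicator (hS A), Measure.restrict_restrict (hS A)]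
    simp [Set.inter_comm]
  have h3 : ∀ x, (∑ A, (S A).indicator (fun _ => (1 : ℝ)) x) * (s - ε) ^ (2 * n) ≤
      q * r ^ (2 * n) * m := by
    intro x
    have := card_lt_infDist_mul_le (k := k) σ hϱq hr x hs hs'
    refine le_trans (le_of_eq ?_) this
    congr 1
    simp [Set.indicator_apply, S]
  have h4 : (∑ A, volume.real (parallelepiped n ∩ S A)) * (s - ε) ^ (2 * n) ≤
      q * r ^ (2 * n) * m * (√3 / 2) ^ n := by
    rw [h2, ← integral_mul_const]
    calc _ ≤ ∫ x in parallelepiped n, (q * r ^ (2 * n) * m : ℝ) := by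
          refine integral_mono ?_ (integrable_const _) h3
          exact (integrable_finsetSum _
            fun A _ => (integrable_const (1 : ℝ)).indicator (hS A)).mul_const _
      _ = _ := by rw [setIntegral_const, hDr, smul_eq_mul, mul_comm]
  have hpow : 0 ≤ (s - ε) ^ (2 * n) := pow_nonneg (sub_nonneg.2 hs') _
  refine le_of_mul_le_mul_right ?_ hv
  calc (#B : ℝ) * (τ * (s - ε) ^ (2 * n)) * (√3 / 2) ^ n
      = #B * (τ * (√3 / 2) ^ n) * (s - ε) ^ (2 * n) := by ring
    _ ≤ (∑ A, volume.real (parallelepiped n ∩ S A)) * (s - ε) ^ (2 * n) :=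
        mul_le_mul_of_nonneg_right h1 hpow
    _ ≤ _ := h4

end Covering

/-! ### The second moment of a full-rank lattice -/

section Moment

variable {n k q : ℕ} [NeZero n] [NeZero q] {ϱ : eisensteinIntegers}
  (σ : (eisensteinIntegers ⧸ Ideal.span {ϱ}) ≃+* ZMod q)

theorem volume_voronoiRegion (hϱ : (ϱ : ℂ) ≠ 0) {r : ℝ}
    (hr : (q : ℝ) ^ k * (Real.pi ^ n * r ^ (2 * n) / n.factorial) = (√3 / 2) ^ n)
    {A : Matrix (Fin n) (Fin k) (ZMod q)} (hA : Function.Injective A.mulVec) :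
    volume (voronoiRegion (constructionA ϱ σ A)) =
      ENNReal.ofReal (Real.pi ^ n * r ^ (2 * n) / n.factorial) := by
  have hq : (0 : ℝ) < q := by exact_mod_cast Nat.pos_of_ne_zero (NeZero.ne q)
  have h := volume_parallelepiped_inter σ hϱ hA (S := Set.univ) .univ (by simp)
  rw [Set.inter_univ, Set.inter_univ, volume_parallelepiped, ← hr,
    ENNReal.ofReal_mul (by positivity)] at h
  have hqk : ((q ^ k : ℕ) : ENNReal) = ENNReal.ofReal ((q : ℝ) ^ k) := by
    rw [← Nat.cast_pow, ENNReal.ofReal_natCast]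
  rw [hqk] at h
  exact ((ENNReal.mul_right_inj (ENNReal.ofReal_pos.2 (by positivity)).ne'
    ENNReal.ofReal_ne_top).1 h).symm

variable (hϱ : (ϱ : ℂ) ≠ 0) {r : ℝ} (hr0 : 0 < r)
  (hr : (q : ℝ) ^ k * (Real.pi ^ n * r ^ (2 * n) / n.factorial) = (√3 / 2) ^ n)
  {A : Matrix (Fin n) (Fin k) (ZMod q)} (hA : Function.Injective A.mulVec)

include hϱ hr hA

theorem volume_voronoiRegion_ne_top : volume (voronoiRegion (constructionA ϱ σ A)) ≠ ⊤ := by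
  rw [volume_voronoiRegion σ hϱ hr hA]; exact ENNReal.ofReal_ne_top

include hr0

theorem volume_real_voronoiRegion :
    volume.real (voronoiRegion (constructionA ϱ σ A)) =
      Real.pi ^ n * r ^ (2 * n) / n.factorial := by
  rw [measureReal_def, volume_voronoiRegion σ hϱ hr hA, ENNReal.toReal_ofReal (by positivity)]

omit hr0 in
theorem integrableOn_norm_sq_voronoiRegion :
    IntegrableOn (fun x : EuclideanSpace ℂ (Fin n) => ‖x‖ ^ 2)
      (voronoiRegion (constructionA ϱ σ A)) := by
  refine Measure.integrableOn_of_bounded (M := n) (volume_voronoiRegion_ne_top σ hϱ hr hA)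
    (by fun_prop) ?_
  filter_upwards [ae_restrict_mem (isClosed_voronoiRegion _).measurableSet] with x hx
  rw [Real.norm_of_nonneg (by positivity)]
  exact norm_sq_le_of_mem_voronoiRegion σ hϱ A hx

/-- On the Voronoi region ‖x‖ is the distance to the lattice, so ‖x‖² ≤ s² off the far set, and the
crude bound n serves on the far set. -/
theorem integral_norm_sq_voronoiRegion_le {s τ : ℝ}
    (h : volume.real (parallelepiped n ∩ {x | s < Metric.infDist x
          (constructionA ϱ σ A : Set (EuclideanSpace ℂ (Fin n)))}) ≤ τ * (√3 / 2) ^ n) :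
    ∫ x in voronoiRegion (constructionA ϱ σ A), ‖x‖ ^ 2 ≤
      (s ^ 2 + n * τ) * (Real.pi ^ n * r ^ (2 * n) / n.factorial) := by
  set V := voronoiRegion (constructionA ϱ σ A) with hV
  set S : Set (EuclideanSpace ℂ (Fin n)) :=
    {x | s < Metric.infDist x (constructionA ϱ σ A : Set (EuclideanSpace ℂ (Fin n)))} with hS
  have hSm : MeasurableSet S := measurableSet_lt_infDist _ _
  have hVm : MeasurableSet V := (isClosed_voronoiRegion _).measurableSet
  have hVr := volume_real_voronoiRegion σ hϱ hr0 hr hA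
  have hfin : IsFiniteMeasure (volume.restrict V) :=
    isFiniteMeasure_restrict.2 (volume_voronoiRegion_ne_top σ hϱ hr hA)
  have hq : (0 : ℝ) < q := by exact_mod_cast Nat.pos_of_ne_zero (NeZero.ne q)
  have hqk : (0 : ℝ) < (q : ℝ) ^ k := by positivity
  -- The far set is lattice-periodic, so its density is the same in the parallelepiped and in the
  -- Voronoi region.
  have hVS : volume.real (V ∩ S) ≤ τ * volume.real V := by
    have h1 := volume_parallelepiped_inter σ hϱ hA hSm fun v hv x => by
      rw [hS, Set.mem_ofPred_eq, Set.mem_ofPred_eq, infDist_add_of_mem hv]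
    rw [measureReal_def, h1, ENNReal.toReal_mul, ← measureReal_def, ENNReal.toReal_natCast,
      Nat.cast_pow, ← hr, ← hVr] at h
    refine le_of_mul_le_mul_left (h.trans (le_of_eq ?_)) hqk
    ring
  have hpt : ∀ x ∈ V, ‖x‖ ^ 2 ≤ s ^ 2 + S.indicator (fun _ => (n : ℝ)) x := by
    intro x hx
    by_cases hxS : x ∈ S
    · rw [Set.indicator_of_mem hxS]
      have := norm_sq_le_of_mem_voronoiRegion σ hϱ A hx
      nlinarith [sq_nonneg s]
    · rw [Set.indicator_of_notMem hxS, add_zero]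
      rw [hS, Set.mem_ofPred_eq, infDist_eq_norm_of_mem_voronoiRegion hx, not_lt] at hxS
      exact pow_le_pow_left₀ (norm_nonneg _) hxS 2
  have hind : Integrable (S.indicator fun _ => (n : ℝ)) (volume.restrict V) :=
    (integrable_const _).indicator hSm
  have hsum : IntegrableOn (fun x => s ^ 2 + S.indicator (fun _ => (n : ℝ)) x) V :=
    Integrable.add (integrable_const (s ^ 2)) hind
  calc ∫ x in V, ‖x‖ ^ 2 ≤ ∫ x in V, (s ^ 2 + S.indicator (fun _ => (n : ℝ)) x) :=
        setIntegral_mono_on (integrableOn_norm_sq_voronoiRegion σ hϱ hr hA)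
          hsum hVm hpt
    _ = s ^ 2 * volume.real V + n * volume.real (V ∩ S) := by
        rw [integral_add (integrable_const _) hind,
          setIntegral_const, integral_indicator hSm, Measure.restrict_restrict hSm,
          setIntegral_const, Set.inter_comm, smul_eq_mul, smul_eq_mul, mul_comm, mul_comm (n : ℝ)]
    _ ≤ s ^ 2 * volume.real V + n * (τ * volume.real V) := by gcongr
    _ = _ := by rw [hVr]; ring

theorem le_integral_norm_sq_voronoiRegion {t : ℝ} (ht : 0 ≤ t) :
    t ^ 2 * (1 - (t / r) ^ (2 * n)) * (Real.pi ^ n * r ^ (2 * n) / n.factorial) ≤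
      ∫ x in voronoiRegion (constructionA ϱ σ A), ‖x‖ ^ 2 := by
  set V := voronoiRegion (constructionA ϱ σ A) with hV
  have hVm : MeasurableSet V := (isClosed_voronoiRegion _).measurableSet
  have hVr := volume_real_voronoiRegion σ hϱ hr0 hr hA
  have hVt := volume_voronoiRegion_ne_top σ hϱ hr hA
  have hfin : IsFiniteMeasure (volume.restrict V) := isFiniteMeasure_restrict.2 hVt
  set b : Set (EuclideanSpace ℂ (Fin n)) := Metric.ball 0 t
  have hb : volume.real b = (t / r) ^ (2 * n) * (Real.pi ^ n * r ^ (2 * n) / n.factorial) := by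
    rw [measureReal_def, volume_complexBall, ← ENNReal.ofReal_pow ht,
      ← ENNReal.ofReal_mul (by positivity), ENNReal.toReal_ofReal (by positivity), div_pow]
    field_simp
  have hdiff : volume.real V - volume.real b ≤ volume.real (V \ b) :=
    le_measureReal_sdiff
  have hbm : MeasurableSet bᶜ := Metric.isOpen_ball.measurableSet.compl
  calc _ = t ^ 2 * (volume.real V - volume.real b) := by rw [hb, hVr]; ring
    _ ≤ t ^ 2 * volume.real (V \ b) := by gcongr
    _ = ∫ x in V, bᶜ.indicator (fun _ => t ^ 2) x := by
        rw [integral_indicator hbm, Measure.restrict_restrict hbm, setIntegral_const, smul_eq_mul,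
          mul_comm, Set.inter_comm, Set.sdiff_eq]
    _ ≤ _ := by
        refine setIntegral_mono_on ((integrable_const _).indicator hbm)
          (integrableOn_norm_sq_voronoiRegion σ hϱ hr hA) hVm fun x _ => ?_
        by_cases hx : x ∈ bᶜ
        · rw [Set.indicator_of_mem hx]
          have : t ≤ ‖x‖ := by simpa [b] using hx
          exact pow_le_pow_left₀ ht this 2
        · rw [Set.indicator_of_notMem hx]
          positivity

/-- The normalized second moment in terms of the mean square `m r²` of the Voronoi region. -/
theorem normalizedSecondMoment_eq :
    normalizedSecondMoment (constructionA ϱ σ A) =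
      ((n.factorial : ℝ) ^ (1 / n : ℝ) / n / (2 * Real.pi)) *
        ((∫ x in voronoiRegion (constructionA ϱ σ A), ‖x‖ ^ 2) /
          (Real.pi ^ n * r ^ (2 * n) / n.factorial) / r ^ 2) := by
  have hn : (n : ℝ) ≠ 0 := by exact_mod_cast NeZero.ne n
  have hroot : (Real.pi ^ n * r ^ (2 * n) / n.factorial) ^ (1 / n : ℝ) =
      Real.pi * r ^ 2 / (n.factorial : ℝ) ^ (1 / n : ℝ) := by
    rw [Real.div_rpow (by positivity) (by positivity), pow_mul, ← mul_pow, one_div,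
      Real.pow_rpow_inv_natCast (by positivity) (NeZero.ne n)]
  have hexp : (2 : ℝ) / ((2 * n : ℕ) : ℝ) = 1 / n := by push_cast; field_simp
  rw [normalizedSecondMoment, secondMoment, volume_real_voronoiRegion σ hϱ hr0 hr hA,
    finrank_complexSpace, hexp, hroot]
  have : 0 < (n.factorial : ℝ) ^ (1 / n : ℝ) := by positivity
  have := Real.pi_pos
  push_cast
  generalize (∫ x in voronoiRegion (constructionA ϱ σ A), ‖x‖ ^ 2) /
          (Real.pi ^ n * r ^ (2 * n) / n.factorial) = a
  field_simp

end Moment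

/-! ### Uniform random matrices -/

open Finset in
-- Independence gives each matrix mass q^(-nk); a finite union bound then replaces probability by
-- counting.
theorem IsIIDUniform.measure_le {Ω : Type*} [MeasurableSpace Ω] {P : Measure Ω} {n k q : ℕ}
    [NeZero q] {G : Ω → Matrix (Fin n) (Fin k) (ZMod q)} (hG : IsIIDUniform P G)
    (p : Matrix (Fin n) (Fin k) (ZMod q) → Prop) [DecidablePred p] :
    P {ω | p (G ω)} ≤
      ENNReal.ofReal (#{A | p A} / Fintype.card (Matrix (Fin n) (Fin k) (ZMod q))) := by
  obtain ⟨hm, hind, hmap⟩ := hG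
  have hentry : ∀ i j a, P ((fun ω => G ω i j) ⁻¹' {a}) = ((q : ENNReal))⁻¹ := by
    intro i j a
    rw [← Measure.map_apply (hm i j) (MeasurableSet.singleton a), hmap,
      PMF.toMeasure_apply_singleton _ _ (MeasurableSet.singleton a)]
    simp [ZMod.card]
  have hA : ∀ A, P {ω | G ω = A} =
      (Fintype.card (Matrix (Fin n) (Fin k) (ZMod q)) : ENNReal)⁻¹ := by
    intro A
    have hset : {ω | G ω = A} = ⋂ x ∈ (univ : Finset (Fin n × Fin k)),
        (fun ω => G ω x.1 x.2) ⁻¹' {A x.1 x.2} := by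
      ext ω
      simp [← Matrix.ext_iff]
    rw [hset, hind.measure_inter_preimage_eq_mul univ fun _ _ => MeasurableSet.singleton _,
      prod_congr rfl fun x _ => hentry x.1 x.2 _, prod_const]
    have hcard : Fintype.card (Matrix (Fin n) (Fin k) (ZMod q)) =
        q ^ (Fintype.card (Fin n × Fin k)) := by
      rw [Fintype.card_congr (Matrix.of (m := Fin n) (n := Fin k) (α := ZMod q)).symm,
        Fintype.card_fun, Fintype.card_fun, ZMod.card, ← pow_mul, Fintype.card_prod, mul_comm]
    rw [card_univ, hcard, Nat.cast_pow, ENNReal.inv_pow]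
  have hsub : {ω | p (G ω)} = ⋃ A ∈ ({A | p A} : Finset _), {ω | G ω = A} := by
    ext ω; simp
  rw [hsub]
  refine (measure_biUnion_finset_le _ _).trans (le_of_eq ?_)
  have hpos : (0 : ℝ) < Fintype.card (Matrix (Fin n) (Fin k) (ZMod q)) := by
    exact_mod_cast Fintype.card_pos
  rw [sum_congr rfl fun A _ => hA A, sum_const, nsmul_eq_mul, ENNReal.ofReal_div_of_pos hpos,
    ENNReal.ofReal_natCast, ENNReal.ofReal_natCast, ENNReal.div_eq_inv_mul, mul_comm]

/-! ### Asymptotics -/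

theorem log_factorial_le (n : ℕ) : Real.log n.factorial ≤ n * Real.log n := by
  rw [← Real.log_pow]
  refine Real.log_le_log (by positivity) ?_
  exact_mod_cast Nat.factorial_le_pow n

theorem le_log_factorial {n : ℕ} (hn : n ≠ 0) :
    n * Real.log n - n ≤ Real.log n.factorial := by
  have h0 : (0 : ℝ) < n := by exact_mod_cast Nat.pos_of_ne_zero hn
  have h := Real.pow_div_factorial_le_exp (n : ℝ) h0.le n
  have h2 := Real.log_le_log (by positivity) h
  rw [Real.log_exp, Real.log_div (by positivity) (by positivity), Real.log_pow] at h2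
  linarith

/-- The logarithm is log(`stirlingSeq` n)/n + log(2n)/(2n) - 1, and the first two terms vanish in
the limit. -/
theorem tendsto_factorial_rpow_div :
    Tendsto (fun n : ℕ => (n.factorial : ℝ) ^ (1 / n : ℝ) / n) atTop (nhds (Real.exp (-1))) := by
  have hlim : Tendsto (fun n : ℕ => (Real.log n.factorial - n * Real.log n) / n) atTop
      (nhds (-1)) := by
    have h1 : Tendsto (fun n : ℕ => Real.log (Stirling.stirlingSeq n) / n) atTop (nhds 0) :=
      (Stirling.tendsto_stirlingSeq_sqrt_pi.log (by positivity)).div_atTop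
        tendsto_natCast_atTop_atTop
    have h2 : Tendsto (fun n : ℕ => Real.log (2 * n : ℝ) / (2 * n : ℝ)) atTop (nhds 0) :=
      Real.isLittleO_log_id_atTop.tendsto_div_nhds_zero.comp
        (tendsto_natCast_atTop_atTop.const_mul_atTop two_pos)
    have h3 := (h1.add h2).sub_const 1
    rw [add_zero, zero_sub] at h3
    refine h3.congr' ?_
    filter_upwards [eventually_ne_atTop 0] with n hn
    have h0 : (0 : ℝ) < n := by exact_mod_cast Nat.pos_of_ne_zero hn
    rw [Stirling.log_stirlingSeq_formula, Real.log_div h0.ne' (Real.exp_ne_zero 1), Real.log_exp]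
    field_simp
    ring
  refine ((Real.continuous_exp.tendsto _).comp hlim).congr' ?_
  filter_upwards [eventually_ne_atTop 0] with n hn
  have h0 : (0 : ℝ) < n := by exact_mod_cast Nat.pos_of_ne_zero hn
  have hf : (0 : ℝ) < n.factorial := by positivity
  rw [Function.comp_apply, Real.rpow_def_of_pos hf]
  have : Real.log n.factorial * (1 / n) - Real.log n =
      (Real.log n.factorial - n * Real.log n) / n := by field_simp
  rw [← this, Real.exp_sub, Real.exp_log h0]

section Rates

variable {k q : ℕ → ℕ} {β rmin : ℝ} {reff : ℕ → ℝ}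

/-- The size of the code satisfies `log (q ^ k) = n log n + O(n)`. -/
theorem exists_abs_log_card_le (hrmin0 : 0 < rmin)
    (hreff : ∀ᶠ n in atTop, (q n : ℝ) ^ k n =
      (Real.sqrt 3 / 2) ^ n * Real.Gamma (n + 1) / (Real.pi ^ n * reff n ^ (2 * n)))
    (hr : ∀ᶠ n in atTop, rmin < reff n ∧ reff n < 2 * rmin) :
    ∃ C : ℝ, 0 ≤ C ∧ ∀ᶠ n : ℕ in atTop, n * Real.log n - C * n ≤ k n * Real.log (q n) ∧
      k n * Real.log (q n) ≤ n * Real.log n + C * n := by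
  set a := |Real.log (√3 / 2)| with ha
  set b := |Real.log Real.pi| with hb
  set c := |Real.log rmin| with hc
  set d := |Real.log (2 * rmin)| with hd
  -- The radius enters to the power 2n with |log r| ≤ c + d; the final 1 pays for the -n in
  -- `le_log_factorial`.
  refine ⟨a + b + 2 * c + 2 * d + 1, by positivity, ?_⟩
  filter_upwards [hreff, hr, eventually_ne_atTop 0] with n h1 ⟨h2, h3⟩ hn
  have h0 : (0 : ℝ) < n := by exact_mod_cast Nat.pos_of_ne_zero hn
  have hr0 : 0 < reff n := hrmin0.trans h2
  have hl1 : Real.log rmin ≤ Real.log (reff n) := Real.log_le_log hrmin0 h2.le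
  have hl2 : Real.log (reff n) ≤ Real.log (2 * rmin) := Real.log_le_log hr0 h3.le
  have hπ := Real.pi_pos
  have hf : (0 : ℝ) < n.factorial := by positivity
  have hs : 0 < √3 / 2 := by positivity
  have hlog : k n * Real.log (q n) = n * Real.log (√3 / 2) + Real.log n.factorial -
      (n * Real.log Real.pi + 2 * n * Real.log (reff n)) := by
    have := congrArg Real.log h1
    rw [Real.Gamma_nat_eq_factorial, Real.log_pow, Real.log_div (by positivity) (by positivity),
      Real.log_mul (by positivity) (by positivity), Real.log_mul (by positivity) (by positivity),
      Real.log_pow, Real.log_pow, Real.log_pow] at this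
    rw [this]; push_cast; ring
  have e1 := le_log_factorial hn
  have e2 := log_factorial_le n
  have f1 := mul_le_mul_of_nonneg_left (le_abs_self (Real.log (√3 / 2))) h0.le
  have f2 := mul_le_mul_of_nonneg_left (neg_abs_le (Real.log (√3 / 2))) h0.le
  have f3 := mul_le_mul_of_nonneg_left (le_abs_self (Real.log Real.pi)) h0.le
  have f4 := mul_le_mul_of_nonneg_left (neg_abs_le (Real.log Real.pi)) h0.le
  have f5 := mul_le_mul_of_nonneg_left ((neg_abs_le (Real.log rmin)).trans hl1) h0.le
  have f6 := mul_le_mul_of_nonneg_left (hl2.trans (le_abs_self (Real.log (2 * rmin)))) h0.le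
  have g1 : 0 ≤ n * c := by positivity
  have g2 : 0 ≤ n * d := by positivity
  rw [← ha] at f1 f2
  rw [← hb] at f3 f4
  rw [← hc] at f5
  rw [← hd] at f6
  rw [hlog]
  constructor <;> nlinarith

theorem tendsto_log_natCast : Tendsto (fun n : ℕ => Real.log n) atTop atTop :=
  Real.tendsto_log_atTop.comp tendsto_natCast_atTop_atTop

theorem eventually_pos_of_log_sq_isLittleO
    (hk : (fun n : ℕ => Real.log n ^ 2) =o[atTop] (fun n => (k n : ℝ))) :
    ∀ᶠ n : ℕ in atTop, Real.log n ^ 2 ≤ k n ∧ 0 < k n := by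
  filter_upwards [hk.bound one_pos, tendsto_log_natCast.eventually_ge_atTop 1] with n h1 h2
  rw [one_mul, Real.norm_of_nonneg (by positivity), Real.norm_of_nonneg (by positivity)] at h1
  refine ⟨h1, ?_⟩
  have : (0 : ℝ) < k n := by nlinarith
  exact_mod_cast this

/-- From k ≤ βn one gets log q ≥ (log n - C)/β, so q is at least a constant times n^(1/β), and 1/β >
1. -/
theorem tendsto_div_card_field {C : ℝ} (hβ : β < 1) (hq : ∀ n, 2 ≤ q n)
    (hkβ : ∀ᶠ n in atTop, (k n : ℝ) ≤ β * n) (hkpos : ∀ᶠ n in atTop, 0 < k n)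
    (hC : ∀ᶠ n : ℕ in atTop, n * Real.log n - C * n ≤ k n * Real.log (q n)) :
    Tendsto (fun n : ℕ => (n : ℝ) / q n) atTop (nhds 0) := by
  have hβ0 : 0 < β := by
    obtain ⟨n, h1, h2, h3⟩ := (hkβ.and (hkpos.and (eventually_gt_atTop 0))).exists
    have h2' : (0 : ℝ) < k n := by exact_mod_cast h2
    have h3' : (0 : ℝ) < n := by exact_mod_cast h3
    by_contra h
    nlinarith [not_lt.1 h]
  have hlim : Tendsto (fun n : ℕ => C / β - (1 / β - 1) * Real.log n) atTop atBot := by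
    have hpos : 0 < 1 / β - 1 := by rw [sub_pos, lt_div_iff₀ hβ0]; linarith
    have := (tendsto_log_natCast.const_mul_atTop hpos)
    exact tendsto_atBot_add_const_left _ _ (tendsto_neg_atTop_atBot.comp this)
  refine squeeze_zero' (.of_forall fun n => by positivity) ?_ (Real.tendsto_exp_atBot.comp hlim)
  filter_upwards [hkβ, hC, eventually_gt_atTop 0] with n h1 h2 h3
  have h0 : (0 : ℝ) < n := by exact_mod_cast h3
  have hq0 : (0 : ℝ) < q n := by exact_mod_cast (zero_lt_two.trans_le (hq n))
  have hlq : 0 ≤ Real.log (q n) := Real.log_natCast_nonneg _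
  have h4 : n * (Real.log n - C) ≤ n * (β * Real.log (q n)) := by
    have := mul_le_mul_of_nonneg_right h1 hlq
    linarith
  have h5 : (Real.log n - C) / β ≤ Real.log (q n) := by
    rw [div_le_iff₀ hβ0]
    linarith [le_of_mul_le_mul_left h4 h0]
  rw [Function.comp_apply, ← Real.log_le_iff_le_exp (by positivity),
    Real.log_div h0.ne' hq0.ne']
  have : (Real.log n - C) / β = 1 / β * Real.log n - C / β := by ring
  linarith

/-- The ratio is at most 2^(-(1 - β)n). -/
theorem tendsto_card_code_div (hβ : β < 1) (hq : ∀ n, 2 ≤ q n)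
    (hkβ : ∀ᶠ n in atTop, (k n : ℝ) ≤ β * n) :
    Tendsto (fun n => (q n : ℝ) ^ k n / (q n : ℝ) ^ n) atTop (nhds 0) := by
  have hlim : Tendsto (fun n : ℕ => -((1 - β) * Real.log 2 * n)) atTop atBot :=
    tendsto_neg_atTop_atBot.comp (tendsto_natCast_atTop_atTop.const_mul_atTop
      (mul_pos (sub_pos.2 hβ) (Real.log_pos one_lt_two)))
  refine squeeze_zero' (.of_forall fun n => by positivity) ?_ (Real.tendsto_exp_atBot.comp hlim)
  filter_upwards [hkβ] with n h1
  have hq0 : (0 : ℝ) < q n := by exact_mod_cast (zero_lt_two.trans_le (hq n))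
  have hl2 : Real.log 2 ≤ Real.log (q n) :=
    Real.log_le_log two_pos (by exact_mod_cast hq n)
  have hl0 : 0 < Real.log 2 := Real.log_pos one_lt_two
  rw [Function.comp_apply, ← Real.log_le_iff_le_exp (by positivity),
    Real.log_div (by positivity) (by positivity), Real.log_pow, Real.log_pow]
  have h2 : 0 ≤ (1 - β) * n := mul_nonneg (sub_pos.2 hβ).le (by positivity)
  nlinarith [mul_le_mul_of_nonneg_left hl2 h2,
    mul_le_mul_of_nonneg_right h1 (hl0.le.trans hl2)]

/-- The field size is subexponential in the dimension. -/
theorem tendsto_card_field_mul_div_pow {C : ℝ} (hC0 : 0 ≤ C) (hq : ∀ n, 2 ≤ q n)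
    (hk : ∀ᶠ n : ℕ in atTop, Real.log n ^ 2 ≤ k n ∧ 0 < k n)
    (hC : ∀ᶠ n : ℕ in atTop, k n * Real.log (q n) ≤ n * Real.log n + C * n)
    {ρ : ℝ} (hρ : 1 < ρ) :
    Tendsto (fun n : ℕ => (n : ℝ) * q n / ρ ^ n) atTop (nhds 0) := by
  have hlρ : 0 < Real.log ρ := Real.log_pos hρ
  -- Of the 3en in n log ρ, log n and log q each use at most en, which leaves decay e^(-en).
  set e := Real.log ρ / 3 with he
  have he0 : 0 < e := by positivity
  have hlim : Tendsto (fun n : ℕ => -(e * n)) atTop atBot :=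
    tendsto_neg_atTop_atBot.comp (tendsto_natCast_atTop_atTop.const_mul_atTop he0)
  refine squeeze_zero' (.of_forall fun n => by positivity) ?_ (Real.tendsto_exp_atBot.comp hlim)
  have hlogn : ∀ᶠ n : ℕ in atTop, Real.log n ≤ e * n := by
    have := (Real.isLittleO_log_id_atTop.comp_tendsto tendsto_natCast_atTop_atTop).bound he0
    filter_upwards [this] with n hn
    simp only [Function.comp_apply, id, Real.norm_natCast] at hn
    exact (le_abs_self _).trans hn
  filter_upwards [hk, hC, hlogn, tendsto_log_natCast.eventually_ge_atTop ((1 + C) / e),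
    tendsto_log_natCast.eventually_ge_atTop 1, eventually_gt_atTop 0] with n ⟨h1, h2⟩ h3 h4 h5 h6 h7
  have h0 : (0 : ℝ) < n := by exact_mod_cast h7
  have hq0 : (0 : ℝ) < q n := by exact_mod_cast (zero_lt_two.trans_le (hq n))
  have hlq : 0 ≤ Real.log (q n) := Real.log_natCast_nonneg _
  rw [div_le_iff₀ he0] at h5
  -- Here k ≥ log² n enters: it gives log q ≤ n(1 + C)/log n, and log n ≥ (1 + C)/e.
  have hl : Real.log (q n) ≤ e * n := by
    set L := Real.log (n : ℝ)
    have hL2 : 0 < L ^ 2 := by positivity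
    refine le_of_mul_le_mul_left ?_ hL2
    calc L ^ 2 * Real.log (q n) ≤ k n * Real.log (q n) := mul_le_mul_of_nonneg_right h1 hlq
      _ ≤ n * L + C * n := h3
      _ ≤ n * L + C * n * L := by
          have : C * n * 1 ≤ C * n * L := mul_le_mul_of_nonneg_left h6 (by positivity)
          linarith
      _ = n * L * (1 + C) := by ring
      _ ≤ n * L * (L * e) := mul_le_mul_of_nonneg_left h5 (by positivity)
      _ = L ^ 2 * (e * n) := by ring
  rw [Function.comp_apply, ← Real.log_le_iff_le_exp (by positivity),
    Real.log_div (by positivity) (by positivity), Real.log_mul h0.ne' hq0.ne', Real.log_pow]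
  have : Real.log ρ = 3 * e := by rw [he]; ring
  rw [this]
  linarith

end Rates

/-! ### Goodness for quantization -/

section Quantization

open Finset

variable {n k q : ℕ} [NeZero n] [NeZero k] [Fact q.Prime] {ϱ : eisensteinIntegers}
  (σ : (eisensteinIntegers ⧸ Ideal.span {ϱ}) ≃+* ZMod q)

omit [NeZero k] in
/-- Unless the code is degenerate or covers badly, the mean square of the Voronoi region is close
to the squared effective radius. -/
theorem normalizedSecondMoment_mem_Icc (hϱ : (ϱ : ℂ) ≠ 0) {r : ℝ} (hr0 : 0 < r)
    (hr : (q : ℝ) ^ k * (Real.pi ^ n * r ^ (2 * n) / n.factorial) = (√3 / 2) ^ n)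
    {δ : ℝ} (hδ1 : δ < 1) {A : Matrix (Fin n) (Fin k) (ZMod q)}
    (hA : Function.Injective A.mulVec)
    (h : volume.real (parallelepiped n ∩ {x | (1 + δ) * r < Metric.infDist x
      (constructionA ϱ σ A : Set (EuclideanSpace ℂ (Fin n)))}) ≤ δ * r ^ 2 / n * (√3 / 2) ^ n) :
    normalizedSecondMoment (constructionA ϱ σ A) ∈ Set.Icc
      ((n.factorial : ℝ) ^ (1 / n : ℝ) / n / (2 * Real.pi) *
        ((1 - δ) ^ 2 * (1 - ((1 - δ) ^ 2) ^ n)))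
      ((n.factorial : ℝ) ^ (1 / n : ℝ) / n / (2 * Real.pi) * ((1 + δ) ^ 2 + δ)) := by
  have hn : (n : ℝ) ≠ 0 := by exact_mod_cast NeZero.ne n
  have hv : 0 < Real.pi ^ n * r ^ (2 * n) / n.factorial := by positivity
  rw [normalizedSecondMoment_eq σ hϱ hr0 hr hA]
  have h1 := integral_norm_sq_voronoiRegion_le σ hϱ hr0 hr hA h
  have h2 := le_integral_norm_sq_voronoiRegion σ hϱ hr0 hr hA
    (mul_nonneg (sub_nonneg.2 hδ1.le) hr0.le)
  constructor
  · refine mul_le_mul_of_nonneg_left ?_ (by positivity)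
    rw [le_div_iff₀ (by positivity), le_div_iff₀ hv]
    refine le_trans (le_of_eq ?_) h2
    rw [mul_div_cancel_right₀ _ hr0.ne', ← pow_mul (1 - δ) 2 n]
    ring
  · refine mul_le_mul_of_nonneg_left ?_ (by positivity)
    rw [div_le_iff₀ (by positivity), div_le_iff₀ hv]
    refine h1.trans (le_of_eq ?_)
    rw [mul_div_cancel₀ _ hn]
    ring

open scoped Classical in
-- A matrix outside the interval is either rank deficient (`B₁`) or leaves too much space uncovered
-- at radius (1 + δ)r (`B₂`); the two terms bound these cases.
theorem card_not_mem_Icc_div_le (hϱq : ‖(ϱ : ℂ)‖ ^ 2 = q) {r rmin : ℝ} (hrmin : 0 < rmin)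
    (hrr : rmin < r)
    (hr : (q : ℝ) ^ k * (Real.pi ^ n * r ^ (2 * n) / n.factorial) = (√3 / 2) ^ n)
    {δ : ℝ} (hδ0 : 0 < δ) (hδ1 : δ < 1) (hδr : (1 + δ) * r < 1 / 2)
    (hε : √(n / q) ≤ δ / 2 * rmin) :
    (#{A : Matrix (Fin n) (Fin k) (ZMod q) |
      normalizedSecondMoment (constructionA ϱ σ A) ∉ Set.Icc
        ((n.factorial : ℝ) ^ (1 / n : ℝ) / n / (2 * Real.pi) *
          ((1 - δ) ^ 2 * (1 - ((1 - δ) ^ 2) ^ n)))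
        ((n.factorial : ℝ) ^ (1 / n : ℝ) / n / (2 * Real.pi) * ((1 + δ) ^ 2 + δ))} : ℝ) /
      Fintype.card (Matrix (Fin n) (Fin k) (ZMod q)) ≤
    (q : ℝ) ^ k / (q : ℝ) ^ n +
      1 / (δ * rmin ^ 2) * ((n : ℝ) * q / ((1 + δ / 2) ^ 2) ^ n) := by
  have hq : (0 : ℝ) < q := by exact_mod_cast Nat.pos_of_ne_zero (NeZero.ne q)
  have hϱ : (ϱ : ℂ) ≠ 0 := by
    intro h; rw [h] at hϱq; simp at hϱq; exact hq.ne hϱq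
  have hr0 : 0 < r := hrmin.trans hrr
  have hn : (0 : ℝ) < n := by exact_mod_cast Nat.pos_of_ne_zero (NeZero.ne n)
  set m := (Fintype.card (Matrix (Fin n) (Fin k) (ZMod q)) : ℝ) with hm
  have hm0 : 0 < m := by rw [hm]; exact_mod_cast Fintype.card_pos
  set B₁ : Finset (Matrix (Fin n) (Fin k) (ZMod q)) := {A | ∃ y, y ≠ 0 ∧ A.mulVec y = 0}
  set B₂ : Finset (Matrix (Fin n) (Fin k) (ZMod q)) :=
    {A | δ * r ^ 2 / n * (√3 / 2) ^ n < volume.real (parallelepiped n ∩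
      {x | (1 + δ) * r < Metric.infDist x
        (constructionA ϱ σ A : Set (EuclideanSpace ℂ (Fin n)))})}
  have hB₁ : (#B₁ : ℝ) / m ≤ (q : ℝ) ^ k / (q : ℝ) ^ n := by
    have h := card_not_injective_mul_le (F := ZMod q) (n := n) (k := k)
    rw [ZMod.card] at h
    rw [div_le_div_iff₀ hm0 (by positivity), hm]
    refine le_trans (le_of_eq ?_) (Nat.cast_le (α := ℝ).2 h |>.trans (le_of_eq ?_))
    · push_cast
      congr!
    · push_cast; rfl
  have hB₂ : (#B₂ : ℝ) / m ≤ 1 / (δ * rmin ^ 2) * ((n : ℝ) * q / ((1 + δ / 2) ^ 2) ^ n) := by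
    -- The grid error uses up half of the margin δr, so the shrunken radius is still at least (1 +
    -- δ/2)r.
    have hε' : √(n / q) ≤ δ / 2 * r := hε.trans (by gcongr)
    have h := card_volume_lt_infDist_mul_le (k := k) σ hϱq hr hδr
      (hε'.trans (by nlinarith)) (δ * r ^ 2 / n)
    have hle : ((1 + δ / 2) * r) ^ (2 * n) ≤ ((1 + δ) * r - √(n / q)) ^ (2 * n) :=
      pow_le_pow_left₀ (by positivity) (by linarith) _
    have h' : (#B₂ : ℝ) * (δ * r ^ 2 / n * ((1 + δ / 2) * r) ^ (2 * n)) ≤ q * r ^ (2 * n) * m :=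
      le_trans (by gcongr) h
    have h'' : (#B₂ : ℝ) * (δ * rmin ^ 2 * ((1 + δ / 2) ^ 2) ^ n) ≤ n * q * m := by
      refine le_of_mul_le_mul_right ?_ (show 0 < r ^ (2 * n) / n by positivity)
      calc (#B₂ : ℝ) * (δ * rmin ^ 2 * ((1 + δ / 2) ^ 2) ^ n) * (r ^ (2 * n) / n)
          ≤ #B₂ * (δ * r ^ 2 * ((1 + δ / 2) ^ 2) ^ n) * (r ^ (2 * n) / n) := by gcongr
        _ = (#B₂ : ℝ) * (δ * r ^ 2 / n * ((1 + δ / 2) * r) ^ (2 * n)) := by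
            rw [mul_pow, ← pow_mul (1 + δ / 2) 2 n]; ring
        _ ≤ q * r ^ (2 * n) * m := h'
        _ = n * q * m * (r ^ (2 * n) / n) := by field_simp
    rw [div_le_iff₀ hm0]
    rw [← le_div_iff₀ (by positivity)] at h''
    refine h''.trans (le_of_eq ?_)
    field_simp
  have hsub : ({A : Matrix (Fin n) (Fin k) (ZMod q) |
      normalizedSecondMoment (constructionA ϱ σ A) ∉ Set.Icc
        ((n.factorial : ℝ) ^ (1 / n : ℝ) / n / (2 * Real.pi) *
          ((1 - δ) ^ 2 * (1 - ((1 - δ) ^ 2) ^ n)))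
        ((n.factorial : ℝ) ^ (1 / n : ℝ) / n / (2 * Real.pi) * ((1 + δ) ^ 2 + δ))} : Finset _) ⊆
      B₁ ∪ B₂ := by
    intro A hA
    rw [mem_filter] at hA
    by_contra hB
    simp only [B₁, B₂, mem_union, mem_filter, mem_univ, true_and, not_or, not_lt] at hB
    refine hA.2 (normalizedSecondMoment_mem_Icc σ hϱ hr0 hr hδ1 ?_ hB.2)
    have : Function.Injective A.mulVecLin := by
      rw [injective_iff_map_eq_zero]
      intro y hy
      by_contra hne
      exact hB.1 ⟨y, hne, hy⟩
    exact this
  calc _ ≤ ((#B₁ : ℝ) + #B₂) / m := by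
        gcongr
        exact_mod_cast (card_le_card hsub).trans (card_union_le _ _)
    _ = #B₁ / m + #B₂ / m := add_div _ _ _
    _ ≤ _ := add_le_add hB₁ hB₂

/-- A tolerance for the covering radius that forces a given tolerance for the second moment. -/
theorem exists_tolerance {c ε R : ℝ} (hε : 0 < ε) (hR : R < 1 / 2) :
    ∃ δ : ℝ, 0 < δ ∧ δ < 1 ∧ (1 + δ) * R < 1 / 2 ∧ c * ((1 + δ) ^ 2 + δ) < c + ε ∧
      c - ε < c * (1 - δ) ^ 2 := by
  -- All the required inequalities are strict at δ = 0, hence persist nearby by continuity.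
  have h1 : ∀ᶠ δ in nhds (0 : ℝ), (1 + δ) * R < 1 / 2 :=
    ContinuousAt.eventually_lt (by fun_prop) continuousAt_const (by simpa using hR)
  have h2 : ∀ᶠ δ in nhds (0 : ℝ), c * ((1 + δ) ^ 2 + δ) < c + ε :=
    ContinuousAt.eventually_lt (by fun_prop) continuousAt_const (by simpa using hε)
  have h3 : ∀ᶠ δ in nhds (0 : ℝ), c - ε < c * (1 - δ) ^ 2 :=
    ContinuousAt.eventually_lt continuousAt_const (by fun_prop) (by simpa using hε)
  have h4 : ∀ᶠ δ in nhds (0 : ℝ), δ < 1 := eventually_lt_nhds one_pos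
  obtain ⟨δ, hδ, hδ0⟩ := (((h4.and (h1.and (h2.and h3))).filter_mono nhdsWithin_le_nhds).and
    (self_mem_nhdsWithin (s := Set.Ioi (0 : ℝ)))).exists
  exact ⟨δ, hδ0, hδ⟩

end Quantization

end EisensteinLattice

end

open EisensteinLattice in
theorem mainTheorem4
    (k q : ℕ → ℕ) [∀ n, Fact (q n).Prime] (hq : ∀ n, q n % 3 = 1)
    (ϱ : ℕ → EisensteinLattice.eisensteinIntegers) (hϱ : ∀ n, Prime (ϱ n))
    (hϱq : ∀ n, ‖(ϱ n : ℂ)‖ ^ 2 = (q n : ℝ))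
    (σ : ∀ n, (EisensteinLattice.eisensteinIntegers ⧸ Ideal.span {ϱ n}) ≃+* ZMod (q n))
    (β : ℝ) (hβ : β < 1) (hkβ : ∀ᶠ n in atTop, (k n : ℝ) ≤ β * n)
    (hk : (fun n : ℕ => Real.log n ^ 2) =o[atTop] (fun n => (k n : ℝ)))
    (rmin : ℝ) (hrmin0 : 0 < rmin) (hrmin : rmin < 1 / 4)
    (reff : ℕ → ℝ)
    (hreff : ∀ᶠ n in atTop, (q n : ℝ) ^ k n =
      (Real.sqrt 3 / 2) ^ n * Real.Gamma (n + 1) / (Real.pi ^ n * reff n ^ (2 * n)))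
    (hr : ∀ᶠ n in atTop, rmin < reff n ∧ reff n < 2 * rmin)
    {Ω : Type*} [MeasurableSpace Ω] (P : Measure Ω) [IsProbabilityMeasure P]
    (G : ∀ n, Ω → Matrix (Fin n) (Fin (k n)) (ZMod (q n)))
    (hG : ∀ n, EisensteinLattice.IsIIDUniform P (G n)) :
    TendstoInMeasure P
      (fun n ω => EisensteinLattice.normalizedSecondMoment
        (EisensteinLattice.constructionA (ϱ n) (σ n) (G n ω)))
      atTop (fun _ => 1 / (2 * Real.pi * Real.exp 1)) := by
  classical
  rw [tendstoInMeasure_iff_norm]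
  intro ε hε
  set c := 1 / (2 * Real.pi * Real.exp 1) with hc
  -- Taking R = 2 rmin, which exceeds every late effective radius, makes one δ valid for all large
  -- n; rmin < 1/4 is what keeps (1 + δ)r below the label-separation threshold 1/2.
  obtain ⟨δ, hδ0, hδ1, hδr, hup, hlow⟩ := exists_tolerance (c := c) (R := 2 * rmin) hε (by linarith)
  have hq2 : ∀ n, 2 ≤ q n := fun n => (Fact.out : (q n).Prime).two_le
  have hk' := eventually_pos_of_log_sq_isLittleO hk
  obtain ⟨C, hC0, hC⟩ := exists_abs_log_card_le hrmin0 hreff hr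
  have hgrid := tendsto_div_card_field hβ hq2 hkβ (hk'.mono fun n h => h.2) (hC.mono fun n h => h.1)
  have hrank := tendsto_card_code_div hβ hq2 hkβ
  have hcover := tendsto_card_field_mul_div_pow hC0 hq2 hk' (hC.mono fun n h => h.2)
    (ρ := (1 + δ / 2) ^ 2) (one_lt_pow₀ (by linarith) two_ne_zero)
  have hbound : Tendsto (fun n => ENNReal.ofReal ((q n : ℝ) ^ k n / (q n : ℝ) ^ n +
      1 / (δ * rmin ^ 2) * ((n : ℝ) * q n / ((1 + δ / 2) ^ 2) ^ n))) atTop (nhds 0) := by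
    have := ENNReal.tendsto_ofReal (hrank.add (hcover.const_mul (1 / (δ * rmin ^ 2))))
    simpa using this
  have hconst : Tendsto (fun n : ℕ => (n.factorial : ℝ) ^ (1 / n : ℝ) / n / (2 * Real.pi)) atTop
      (nhds c) := by
    have := tendsto_factorial_rpow_div.div_const (2 * Real.pi)
    rwa [Real.exp_neg, inv_eq_one_div, div_div, mul_comm (Real.exp 1)] at this
  have hevup := (hconst.mul_const ((1 + δ) ^ 2 + δ)).eventually_lt_const hup
  have hpow : Tendsto (fun n : ℕ => ((1 - δ) ^ 2) ^ n) atTop (nhds 0) :=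
    tendsto_pow_atTop_nhds_zero_of_lt_one (sq_nonneg _) (by nlinarith)
  have hevlow : ∀ᶠ n : ℕ in atTop, c - ε < (n.factorial : ℝ) ^ (1 / n : ℝ) / n / (2 * Real.pi) *
      ((1 - δ) ^ 2 * (1 - ((1 - δ) ^ 2) ^ n)) := by
    have := hconst.mul ((hpow.const_sub 1).const_mul ((1 - δ) ^ 2))
    rw [sub_zero, mul_one] at this
    exact this.eventually_const_lt hlow
  have hevgrid : ∀ᶠ n : ℕ in atTop, √((n : ℝ) / q n) ≤ δ / 2 * rmin := by
    have := hgrid.sqrt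
    rw [Real.sqrt_zero] at this
    exact this.eventually_le_const (by positivity)
  refine tendsto_of_tendsto_of_tendsto_of_le_of_le' tendsto_const_nhds hbound
    (.of_forall fun _ => zero_le) ?_
  filter_upwards [hk', hreff, hr, hevup, hevlow, hevgrid, eventually_ne_atTop 0]
    with n ⟨_, hkn⟩ hreffn ⟨hr1, hr2⟩ hupn hlown hgridn hn
  have : NeZero n := ⟨hn⟩
  have : NeZero (k n) := ⟨hkn.ne'⟩
  have hr0 : 0 < reff n := hrmin0.trans hr1
  have hvol : (q n : ℝ) ^ k n * (Real.pi ^ n * reff n ^ (2 * n) / n.factorial) = (√3 / 2) ^ n := by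
    rw [hreffn, Real.Gamma_nat_eq_factorial]
    have := Real.pi_pos
    field_simp
  refine (measure_mono fun ω hω => ?_).trans (((hG n).measure_le fun A =>
    normalizedSecondMoment (constructionA (ϱ n) (σ n) A) ∉ Set.Icc
        ((n.factorial : ℝ) ^ (1 / n : ℝ) / n / (2 * Real.pi) *
          ((1 - δ) ^ 2 * (1 - ((1 - δ) ^ 2) ^ n)))
        ((n.factorial : ℝ) ^ (1 / n : ℝ) / n / (2 * Real.pi) * ((1 + δ) ^ 2 + δ))).trans
    (ENNReal.ofReal_le_ofReal (card_not_mem_Icc_div_le (σ n) (hϱq n) hrmin0 hr1 hvol hδ0 hδ1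
      (lt_of_le_of_lt (by gcongr) hδr) hgridn)))
  intro hmem
  have hω' : ε ≤ |normalizedSecondMoment (constructionA (ϱ n) (σ n) (G n ω)) - c| := hω
  refine absurd hω' (not_le.2 (abs_lt.2 ⟨?_, ?_⟩)) <;> linarith [hmem.1, hmem.2]
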